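/- There is an absolute constant $c>0$ such that for every $\varepsilon>0$ there is $Q=Q(\varepsilon)$ with the following property. Let $0<\delta\le c\,\varepsilon^4$, let $p$ be a prime, and let $K$ be a finite extension of $\mathbb{Q}_p$ with ring of integers $\mathcal{O}$, uniformizing element $\mathfrak{p}$ and residue field $\mathfrak{f}=\mathcal{O}/\langle\mathfrak{p}\rangle$ such that $|\mathfrak{f}|\ge Q$. For $n\ge 0$ let $\pi_{\mathfrak{p}^n}:\mathcal{O}\to\mathcal{O}/\langle\mathfrak{p}^n\rangle$ be the residue map, and for $n\le N$ write $\pi_{\mathfrak{p}^n}$ also for the induced map $\pi_{\mathfrak{p}^N}(\mathcal{O})\to\pi_{\mathfrak{p}^n}(\mathcal{O})$. Let $\Omega\subseteq\mathcal{O}$ be such that $\pi_{\mathfrak{p}}$ induces a bijection between $\Omega$ and $\mathfrak{f}^\times$. Let $N\ge 2$ and let $A\subseteq\pi_{\mathfrak{p}^N}(\mathcal{O})$ be a non-empty set such that 1. $A$ is $(m_0,\ldots,m_{N-1})$-regular, that is, for every $0\le n\le N-1$ and every $x\in\mathcal{O}$ with $\pi_{\mathfrak{p}^n}(x)\in\pi_{\mathfrak{p}^n}(A)$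 one has $|\pi_{\mathfrak{p}^{n+1}}(A)\cap\pi_{\mathfrak{p}^{n+1}}(x+\mathfrak{p}^n\mathcal{O})|=m_n$; and $m_0,m_1>1$; 2. $|A|\le|\mathfrak{f}|^{N(1-\varepsilon)}$; 3. $|\pi_{\mathfrak{p}^l}(A)|\ge|\mathfrak{f}|^{l\varepsilon}$ for every integer $l$ with $N\delta\le l\le N$. Then $$\max_{\omega\in\Omega,\ a\in A-A}|A+\pi_{\mathfrak{p}^N}(\omega)\,a\,A|\ \ge\ |A|\,|\mathfrak{f}|^{N\delta}.$$ -/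

import Mathlib

open scoped Pointwise

namespace PadicSumProduct

/-- The ring of integers `𝒪` of an extension `K` of `ℚ_p`: the elements of `K` that are integral
over `ℤ_p`. -/
noncomputable def ringOfIntegers (p : ℕ) [Fact p.Prime] (K : Type*) [Field K] [Algebra ℚ_[p] K] : Subring K :=
  letI : Algebra ℤ_[p] K := ((algebraMap ℚ_[p] K).comp PadicInt.Coe.ringHom).toAlgebra
  (integralClosure ℤ_[p] K).toSubring

variable {R : Type*} [CommRing R]

/-- `ϖ` is a uniformizing element of the discrete valuation ring `R`: a nonzero generator of the
maximal ideal. (The rings of integers it is used for are local, so that a maximal ideal is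
the maximal ideal.) -/
def IsUniformizer (ϖ : R) : Prop :=
  ϖ ≠ 0 ∧ (Ideal.span {ϖ}).IsMaximal

/-- For a subset `A` of `R / I ^ N` and `l ≤ N`, the image of `A` in `R / I ^ l`. -/
def levelImage (I : Ideal R) {N : ℕ} (A : Set (R ⧸ I ^ N)) (l : ℕ) (h : l ≤ N) :
    Set (R ⧸ I ^ l) :=
  Ideal.Quotient.factorPow I h '' A

/-- `A ⊆ R / I ^ N` is `(m_0, …, m_{N-1})`-regular: for every `n < N` and every residue class
`x + I ^ n` that belongs to the image of `A` in `R / I ^ n`, the image of `A` in `R / I ^ (n + 1)`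
has exactly `m_n` elements in the image of `x + I ^ n`. -/
def IsRegularSubset (I : Ideal R) {N : ℕ} (m : Fin N → ℕ) (A : Set (R ⧸ I ^ N)) : Prop :=
  ∀ (n : Fin N) (x : R),
    Ideal.Quotient.mk (I ^ (n : ℕ)) x ∈ levelImage I A n n.isLt.le →
      (levelImage I A (n + 1) n.isLt ∩
        Ideal.Quotient.mk (I ^ ((n : ℕ) + 1)) '' {y : R | y - x ∈ I ^ (n : ℕ)}).ncard = m n

end PadicSumProduct

namespace PadicSumProduct

open Finset

/-! ### Schnirelmann's inequality on an initial segment -/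

/-! Write `q` for the size of the residue field and `α n = log (m n) / log q`. Choose
representatives `𝒜` of `A`, take `x, y` uniformly from `𝒜`, and let `a` be a difference of two
elements of `𝒜` of exact valuation `k`. The classes of `x` mod `I ^ n` and of `y` mod `I ^ (n - k)`
determine `x + ω a y` mod `I ^ n`. By submodularity (`coEntropy_add_le`), passing to level `n + 1`
therefore adds at least the entropy of the new class conditional on that pair.

Fixing `y` shows that this increment is at least `log (m n)`. Averaging over `ω` improves it: two
pairs whose second coordinates differ at level `n - k + 1` collide for at most one `ω`
(`sum_card_jointFiber_le`). The improvement, in units of `log q`, is `max 0 (min (α (n - k)) (1 - α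
n) - η)` with `η = log 3 / log q`. Summed over levels, this bounds the size of `A + ω a A` from
below for some `ω`.

It remains to find `k` with `m k > 1` and total improvement at least `N δ` (`exists_large_gain`). If
there is none, then `k = 0` shows that `α` is mostly near `0` or `1`, and the other `k` show that `E
= {α ≥ 1/2}` is almost invariant under translation by `1` and by its own elements. The size
hypotheses give `E` positive density on initial segments and a complement of positive density. A
Schnirelmann argument makes `E` almost invariant under every not too short translation, and double
counting then gives a contradiction (`false_of_overflow_le`). -/

open Classical in
/-- The number of positive elements of `S` up to `n`. -/
noncomputable def posCount (S : Set ℕ) (n : ℕ) : ℕ := #{j ∈ Ioc 0 n | j ∈ S}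

lemma posCount_zero (S : Set ℕ) : posCount S 0 = 0 := by simp [posCount]

lemma posCount_add_le (U T : Set ℕ) (g l : ℕ) (h : ∀ j ∈ T, 0 < j → g + j ∈ U) :
    posCount U g + posCount T l ≤ posCount U (g + l) := by
  classical
  unfold posCount
  have himg : (#{j ∈ Ioc 0 l | j ∈ T}) = #((({j ∈ Ioc 0 l | j ∈ T}).image (g + ·))) :=
    (card_image_of_injective _ (add_right_injective g)).symm
  rw [himg, ← card_union_of_disjoint]
  · apply card_le_card
    intro n hn
    simp only [mem_union, mem_filter, mem_Ioc, mem_image] at hn ⊢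
    rcases hn with ⟨h1, h2⟩ | ⟨j, ⟨h1, h2⟩, rfl⟩
    · exact ⟨by omega, h2⟩
    · exact ⟨by omega, h j h2 h1.1⟩
  · rw [Finset.disjoint_left]
    intro n hn hn'
    simp only [mem_filter, mem_Ioc, mem_image] at hn hn'
    obtain ⟨j, ⟨h1, h2⟩, rfl⟩ := hn'
    omega

lemma posCount_eq_of_forall_notMem (S : Set ℕ) {g n : ℕ} (hg : g ≤ n)
    (h : ∀ j, g < j → j ≤ n → j ∉ S) : posCount S n = posCount S g := by
  classical
  unfold posCount
  congr 1
  ext j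
  simp only [mem_filter, mem_Ioc]
  constructor
  · rintro ⟨h1, h2⟩
    refine ⟨⟨h1.1, ?_⟩, h2⟩
    by_contra hlt
    exact h j (by omega) h1.2 h2
  · rintro ⟨h1, h2⟩
    exact ⟨⟨h1.1, by omega⟩, h2⟩

lemma posCount_succ_of_mem (S : Set ℕ) {n : ℕ} (h : n + 1 ∈ S) :
    posCount S (n + 1) = posCount S n + 1 := by
  classical
  unfold posCount
  have : Ioc 0 (n + 1) = insert (n + 1) (Ioc 0 n) := by ext; simp; omega
  rw [this, filter_insert, if_pos h, card_insert_of_notMem (by simp)]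

/-- Each gap of `S` is filled by a translate of `T` starting at the element of `S` before the gap,
which covers a proportion `β` of the gap. The inclusion `T ⊆ U` serves the initial gap, which starts
at `0` whether or not `0 ∈ S`. -/
lemma le_posCount_add {M : ℕ} {S T U : Set ℕ} (hSU : S ⊆ U) (hTU : T ⊆ U) {β : ℝ}
    (hadd : ∀ s ∈ S, ∀ t ∈ T, s + t ∈ U) (hT : ∀ n ≤ M, β * n ≤ posCount T n) :
    ∀ n ≤ M, (posCount S n : ℝ) + β * (n - posCount S n) ≤ posCount U n := by
  classical
  intro n
  induction n using Nat.strong_induction_on with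
  | _ n ih =>
  intro hn
  rcases Nat.eq_zero_or_pos n with rfl | hpos
  · simp [posCount_zero]
  by_cases hnS : n ∈ S
  · obtain ⟨k, rfl⟩ : ∃ k, n = k + 1 := ⟨n - 1, by omega⟩
    have := ih k (by omega) (by omega)
    rw [posCount_succ_of_mem S hnS, posCount_succ_of_mem U (hSU hnS)]
    push_cast
    linarith
  · obtain ⟨g, hgn, hg, hgS⟩ : ∃ g < n, (∀ j, g < j → j ≤ n → j ∉ S) ∧ (g = 0 ∨ g ∈ S) := by
      by_cases hex : ∃ g < n, g ∈ S
      · have hne : ({j ∈ range n | j ∈ S}).Nonempty := by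
          obtain ⟨g, h1, h2⟩ := hex
          exact ⟨g, by simp [h1, h2]⟩
        have hmem := max'_mem _ hne
        simp only [mem_filter, mem_range] at hmem
        refine ⟨_, hmem.1, fun j hj hjn hjS => ?_, Or.inr hmem.2⟩
        rcases hjn.lt_or_eq with hlt | rfl
        · exact absurd (le_max' {j ∈ range n | j ∈ S} j (by simp [hlt, hjS])) (by omega)
        · exact hnS hjS
      · push Not at hex
        refine ⟨0, hpos, fun j _ hjn hjS => ?_, Or.inl rfl⟩
        rcases hjn.lt_or_eq with hlt | rfl
        · exact hex j hlt hjS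
        · exact hnS hjS
    have h1 := ih g hgn (by omega)
    have h2 := hT (n - g) (by omega)
    have h3 : posCount U g + posCount T (n - g) ≤ posCount U (g + (n - g)) := by
      apply posCount_add_le
      intro j hj _
      rcases hgS with rfl | hgS
      · simpa using hTU hj
      · exact hadd g hgS j hj
    rw [show g + (n - g) = n by omega] at h3
    rw [posCount_eq_of_forall_notMem S hgn.le hg]
    have h3' : (posCount U g : ℝ) + posCount T (n - g) ≤ posCount U n := by exact_mod_cast h3
    rw [Nat.cast_sub hgn.le] at h2
    linarith

/-- Pigeonhole: `S` and `n - T` together have at least `n + 2` elements in `[0, n]`, the two extra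
ones coming from `0`, so they meet. -/
lemma mem_of_le_posCount_add {n : ℕ} {S T U : Set ℕ} (hS0 : 0 ∈ S) (hT0 : 0 ∈ T)
    (hadd : ∀ s ∈ S, ∀ t ∈ T, s + t ∈ U) (h : n ≤ posCount S n + posCount T n) : n ∈ U := by
  classical
  have hcard : ∀ V : Set ℕ, 0 ∈ V → #{j ∈ range (n + 1) | j ∈ V} = posCount V n + 1 := by
    intro V hV
    have : range (n + 1) = insert 0 (Ioc 0 n) := by ext; simp
    rw [this, filter_insert, if_pos hV, card_insert_of_notMem (by simp)]
    rfl
  have h1 := hcard S hS0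
  have h2 := hcard T hT0
  have himg : #(({j ∈ range (n + 1) | j ∈ T}).image (n - ·)) = #{j ∈ range (n + 1) | j ∈ T} := by
    apply card_image_of_injOn
    intro a ha b hb hab
    simp at ha hb hab
    omega
  by_contra hnU
  have hdisj : Disjoint ({j ∈ range (n + 1) | j ∈ S})
      (({j ∈ range (n + 1) | j ∈ T}).image (n - ·)) := by
    rw [Finset.disjoint_left]
    intro a ha hb
    simp only [mem_filter, mem_range, mem_image] at ha hb
    obtain ⟨b, ⟨hb1, hb2⟩, rfl⟩ := hb
    apply hnU
    have := hadd _ ha.2 _ hb2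
    rwa [show n - b + b = n by omega] at this
  have hle := card_le_card (union_subset (filter_subset (· ∈ S) (range (n + 1)))
    (show ({j ∈ range (n + 1) | j ∈ T}).image (n - ·) ⊆ range (n + 1) by
      intro a ha
      simp only [mem_filter, mem_range, mem_image] at ha ⊢
      omega))
  rw [card_union_of_disjoint hdisj, card_range] at hle
  omega

/-- A graded family of sets, whose first member has Schnirelmann density at least `σ` up to `M`,
contains everything up to `M` from degree `2 ⌈1 / σ⌉` on. -/
lemma mem_of_schnirelmann {M : ℕ} {T : ℕ → Set ℕ} {σ : ℝ} (hσ : 0 < σ) (hσ1 : σ ≤ 1)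
    (h0 : 0 ∈ T 1) (hadd : ∀ a b, ∀ s ∈ T a, ∀ t ∈ T b, s + t ∈ T (a + b))
    (hT : ∀ n ≤ M, σ * n ≤ posCount (T 1) n) : ∀ n ≤ M, n ∈ T (2 * ⌈1 / σ⌉₊) := by
  have hzero : ∀ h, 0 ∈ T (h + 1) := by
    intro h
    induction h with
    | zero => exact h0
    | succ h ih => simpa using hadd _ _ 0 ih 0 h0
  have hdens : ∀ h, ∀ n ≤ M, (1 - (1 - σ) ^ (h + 1)) * n ≤ posCount (T (h + 1)) n := by
    intro h
    induction h with
    | zero => intro n hn; simpa using hT n hn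
    | succ h ih =>
      intro n hn
      have key := le_posCount_add (M := M) (S := T (h + 1)) (T := T 1) (U := T (h + 1 + 1))
        (fun s hs => by simpa using hadd _ _ s hs 0 h0)
        (fun s hs => by simpa using hadd _ _ 0 (hzero h) s hs)
        (fun s hs t ht => hadd _ _ s hs t ht) hT n hn
      have := mul_le_mul_of_nonneg_left (ih n hn) (sub_nonneg.2 hσ1)
      rw [pow_succ]
      linarith
  obtain ⟨h, hh⟩ : ∃ h, ⌈1 / σ⌉₊ = h + 1 :=
    ⟨⌈1 / σ⌉₊ - 1, by have : 0 < ⌈1 / σ⌉₊ := Nat.ceil_pos.2 (by positivity); omega⟩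
  -- Once the density reaches `1/2`, one doubling covers everything; this is the factor `2` in `2 *
  -- ⌈1 / σ⌉₊`.
  have hhalf : (1 - σ) ^ (h + 1) ≤ 1 / 2 := by
    have h1 : 1 ≤ σ * ((h + 1 : ℕ) : ℝ) := by
      have := Nat.le_ceil (1 / σ)
      rw [hh, div_le_iff₀ hσ] at this
      linarith
    calc (1 - σ) ^ (h + 1) ≤ (Real.exp (-σ)) ^ (h + 1) :=
          pow_le_pow_left₀ (sub_nonneg.2 hσ1) (Real.one_sub_le_exp_neg σ) _
      _ = Real.exp (-(σ * ((h + 1 : ℕ) : ℝ))) := by rw [← Real.exp_nat_mul]; ring_nf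
      _ ≤ Real.exp (-1) := Real.exp_le_exp.2 (by linarith)
      _ ≤ 1 / 2 := by
          rw [Real.exp_neg, one_div]
          exact inv_anti₀ (by norm_num) (by have := Real.add_one_le_exp (1 : ℝ); linarith)
  intro n hn
  rw [hh, two_mul]
  refine mem_of_le_posCount_add (hzero h) (hzero h) (hadd _ _) ?_
  have h1 := hdens h n hn
  have h2 : (0 : ℝ) ≤ n := Nat.cast_nonneg n
  have : (n : ℝ) ≤ posCount (T (h + 1)) n + posCount (T (h + 1)) n := by nlinarith
  exact_mod_cast this
/-! ### Finite entropy -/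

section Entropy

variable {T S S₁ S₂ S₃ : Type*} [Fintype T]

open Classical in
/-- The number of points with the same label as `t`. -/
noncomputable def fiberCard (f : T → S) (t : T) : ℕ := #{t' | f t' = f t}

/-- The sum over all points of the logarithm of the size of the fibre; up to normalization this
is minus the Shannon entropy of the label of a uniformly random point. -/
noncomputable def coEntropy (f : T → S) : ℝ := ∑ t, Real.log (fiberCard f t)

lemma fiberCard_pos (f : T → S) (t : T) : 0 < fiberCard f t :=
  card_pos.2 ⟨t, by simp⟩

/-- Submodularity of entropy. -/
lemma coEntropy_add_le (z : T → S₁) (z' : T → S₂) (p : T → S₃)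
    (hz' : ∀ s t, z' s = z' t → z s = z t) (hp : ∀ s t, p s = p t → z s = z t) :
    coEntropy z' + coEntropy p ≤ coEntropy z + coEntropy (fun t => (p t, z' t)) := by
  classical
  set pz : T → S₃ × S₂ := fun t => (p t, z' t) with hpz
  -- After `log v ≤ v - 1`, submodularity reduces to this count. The numerator counts pairs `(s, u)`
  -- with `z' s = z' t` and `p u = p t`. For fixed `(s, u)` the admissible `t` are empty or one
  -- fibre of `(p, z')`, and in the latter case `z u = z s`.
  have hsum : ∑ t, ((fiberCard z' t : ℝ) * fiberCard p t) / (fiberCard z t * fiberCard pz t)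
      ≤ ∑ _t : T, (1 : ℝ) := by
    have h1 : ∀ t, ((fiberCard z' t : ℝ) * fiberCard p t) / (fiberCard z t * fiberCard pz t) =
        ∑ s, ∑ u, if z' s = z' t ∧ p u = p t then
          ((fiberCard z t : ℝ) * fiberCard pz t)⁻¹ else 0 := by
      intro t
      have : ∀ s u, (if z' s = z' t ∧ p u = p t then
          ((fiberCard z t : ℝ) * fiberCard pz t)⁻¹ else 0) =
          (if z' s = z' t then (1 : ℝ) else 0) * ((if p u = p t then (1 : ℝ) else 0) *
            ((fiberCard z t : ℝ) * fiberCard pz t)⁻¹) := by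
        intro s u
        split_ifs <;> simp_all
      simp only [this]
      rw [← sum_mul_sum, ← sum_mul]
      simp only [sum_boole, div_eq_mul_inv, mul_assoc]
      rfl
    simp only [h1]
    rw [sum_comm]
    apply sum_le_sum
    intro s _
    rw [sum_comm]
    have h2 : ∀ u, (∑ t, if z' s = z' t ∧ p u = p t then
        ((fiberCard z t : ℝ) * fiberCard pz t)⁻¹ else 0) ≤
        if z u = z s then ((fiberCard z s : ℝ))⁻¹ else 0 := by
      intro u
      by_cases hex : ∃ t, z' s = z' t ∧ p u = p t
      · obtain ⟨t₀, ht₀, hu₀⟩ := hex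
        rw [if_pos ((hp _ _ hu₀).trans (hz' _ _ ht₀).symm)]
        have h3 : ∀ t, (if z' s = z' t ∧ p u = p t then
            ((fiberCard z t : ℝ) * fiberCard pz t)⁻¹ else 0) =
            (if pz t = pz t₀ then (1 : ℝ) else 0) *
              ((fiberCard z s : ℝ) * fiberCard pz t₀)⁻¹ := by
          intro t
          have hiff : (z' s = z' t ∧ p u = p t) ↔ pz t = pz t₀ := by
            simp only [hpz, Prod.mk.injEq, ← ht₀, ← hu₀]
            exact ⟨fun h => ⟨h.2.symm, h.1.symm⟩, fun h => ⟨h.2.symm, h.1.symm⟩⟩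
          by_cases h : pz t = pz t₀
          · rw [if_pos (hiff.2 h), if_pos h, one_mul]
            have e1 : fiberCard z t = fiberCard z s := by
              unfold fiberCard
              rw [hz' _ _ (hiff.2 h).1]
            have e2 : fiberCard pz t = fiberCard pz t₀ := by
              unfold fiberCard
              rw [h]
            rw [e1, e2]
          · rw [if_neg (fun h' => h (hiff.1 h')), if_neg h, zero_mul]
        simp only [h3]
        rw [← sum_mul, sum_boole, mul_inv, mul_left_comm]
        have : ((#{t | pz t = pz t₀} : ℕ) : ℝ) = fiberCard pz t₀ := by
          unfold fiberCard; congr!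
        rw [this, mul_inv_cancel₀ (by exact_mod_cast (fiberCard_pos pz t₀).ne'), mul_one]
      · push Not at hex
        rw [sum_eq_zero]
        · split_ifs <;> positivity
        · intro t _
          rw [if_neg (fun h => hex t h.1 h.2)]
    refine (sum_le_sum fun u _ => h2 u).trans ?_
    have h4 : ∀ u, (if z u = z s then ((fiberCard z s : ℝ))⁻¹ else 0) =
        (if z u = z s then (1 : ℝ) else 0) * ((fiberCard z s : ℝ))⁻¹ := by
      intro u; split_ifs <;> simp
    simp only [h4]
    rw [← sum_mul, sum_boole]
    have : ((#{u | z u = z s} : ℕ) : ℝ) = fiberCard z s := by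
      unfold fiberCard; congr!
    rw [this, mul_inv_cancel₀ (by exact_mod_cast (fiberCard_pos z s).ne')]
  unfold coEntropy
  rw [← sum_add_distrib, ← sum_add_distrib, ← sub_nonpos, ← sum_sub_distrib]
  have hterm : ∀ t, Real.log (fiberCard z' t) + Real.log (fiberCard p t) -
      (Real.log (fiberCard z t) + Real.log (fiberCard pz t)) ≤
      ((fiberCard z' t : ℝ) * fiberCard p t) / (fiberCard z t * fiberCard pz t) - 1 := by
    intro t
    have a1 : (0 : ℝ) < fiberCard z t := by exact_mod_cast fiberCard_pos z t
    have a2 : (0 : ℝ) < fiberCard z' t := by exact_mod_cast fiberCard_pos z' t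
    have a3 : (0 : ℝ) < fiberCard p t := by exact_mod_cast fiberCard_pos p t
    have a4 : (0 : ℝ) < fiberCard pz t := by exact_mod_cast fiberCard_pos pz t
    rw [← Real.log_mul a2.ne' a3.ne', ← Real.log_mul a1.ne' a4.ne',
      ← Real.log_div (by positivity) (by positivity)]
    exact Real.log_le_sub_one_of_pos (by positivity)
  refine (sum_le_sum fun t _ => hterm t).trans ?_
  rw [sum_sub_distrib]
  linarith

/-- Entropy is at most the logarithm of the number of values. -/
lemma card_mul_log_card_sub_coEntropy_le [Nonempty T] [DecidableEq S] (f : T → S) :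
    Fintype.card T * Real.log (Fintype.card T) - coEntropy f ≤
      Fintype.card T * Real.log #(univ.image f) := by
  classical
  have hT : (0 : ℝ) < Fintype.card T := by exact_mod_cast Fintype.card_pos
  have him : (0 : ℝ) < #(univ.image f) := by
    exact_mod_cast card_pos.2 (univ_nonempty.image f)
  have hinv : ∑ t, ((fiberCard f t : ℝ))⁻¹ = #(univ.image f) := by
    rw [← sum_fiberwise_of_maps_to (s := univ) (t := univ.image f) (g := f)
      (fun t _ => mem_image_of_mem f (mem_univ t)), card_eq_sum_ones, Nat.cast_sum]
    apply sum_congr rfl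
    intro s hs
    obtain ⟨t₀, -, rfl⟩ := mem_image.1 hs
    have : ∀ t ∈ ({t | f t = f t₀} : Finset T), ((fiberCard f t : ℝ))⁻¹ =
        ((fiberCard f t₀ : ℝ))⁻¹ := by
      intro t ht
      unfold fiberCard
      rw [(mem_filter.1 ht).2]
    rw [sum_congr rfl this, sum_const, nsmul_eq_mul]
    have h2 : ((#{t | f t = f t₀} : ℕ) : ℝ) = fiberCard f t₀ := by
      unfold fiberCard; congr!
    rw [h2, mul_inv_cancel₀ (by exact_mod_cast (fiberCard_pos f t₀).ne')]
    simp
  have hterm : ∀ t, Real.log (Fintype.card T) - Real.log (fiberCard f t) -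
      Real.log #(univ.image f) ≤
      (Fintype.card T / #(univ.image f) : ℝ) * ((fiberCard f t : ℝ))⁻¹ - 1 := by
    intro t
    have a1 : (0 : ℝ) < fiberCard f t := by exact_mod_cast fiberCard_pos f t
    rw [← Real.log_div hT.ne' a1.ne', ← Real.log_div (by positivity) him.ne']
    refine (Real.log_le_sub_one_of_pos (by positivity)).trans (le_of_eq ?_)
    field_simp
  have hs := sum_le_sum fun t (_ : t ∈ univ) => hterm t
  rw [sum_sub_distrib, sum_sub_distrib, sum_sub_distrib, ← mul_sum, hinv,
    div_mul_cancel₀ _ him.ne'] at hs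
  simp only [sum_const, card_univ, nsmul_eq_mul, mul_one] at hs
  unfold coEntropy
  linarith

/-- Jensen's inequality for the logarithm, in the form of a bound on a sum. -/
lemma sum_log_le {ι : Type*} (s : Finset ι) (v : ι → ℝ) (hv : ∀ i ∈ s, 0 < v i) {V : ℝ}
    (hV : 0 < V) (h : ∑ i ∈ s, v i ≤ #s * V) : ∑ i ∈ s, Real.log (v i) ≤ #s * Real.log V := by
  have hterm : ∀ i ∈ s, Real.log (v i) ≤ v i / V - 1 + Real.log V := by
    intro i hi
    have := Real.log_le_sub_one_of_pos (div_pos (hv i hi) hV)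
    rw [Real.log_div (hv i hi).ne' hV.ne'] at this
    linarith
  refine (sum_le_sum hterm).trans ?_
  rw [sum_add_distrib, sum_sub_distrib, ← sum_div]
  simp only [sum_const, nsmul_eq_mul, mul_one]
  have : (∑ i ∈ s, v i) / V ≤ #s := by rw [div_le_iff₀ hV]; exact h
  linarith

end Entropy
/-! ### Sets of integers that are almost closed under translations by their elements -/

/-- The number of elements of `(E + k) ∩ [0, N)` outside `E`. -/
def overflow (E : Finset ℕ) (N k : ℕ) : ℕ := #{n ∈ range N | k ≤ n ∧ n - k ∈ E ∧ n ∉ E}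

/-- On the way from `n - (j + k) ∈ E` to `n ∉ E`, the set is left either before or after the
intermediate point `n - k`. -/
lemma overflow_add_le (E : Finset ℕ) (N j k : ℕ) :
    overflow E N (j + k) ≤ overflow E N j + overflow E N k := by
  unfold overflow
  have h : {n ∈ range N | j + k ≤ n ∧ n - (j + k) ∈ E ∧ n ∉ E} ⊆
      ({n ∈ range N | j ≤ n ∧ n - j ∈ E ∧ n ∉ E}.image (· + k)) ∪
      {n ∈ range N | k ≤ n ∧ n - k ∈ E ∧ n ∉ E} := by
    intro n hn
    simp only [mem_filter, mem_range, mem_union, mem_image] at hn ⊢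
    obtain ⟨h1, h2, h3, h4⟩ := hn
    by_cases h5 : n - k ∈ E
    · exact Or.inr ⟨h1, by omega, h5, h4⟩
    · refine Or.inl ⟨n - k, ⟨by omega, by omega, ?_, h5⟩, by omega⟩
      rwa [show n - k - j = n - (j + k) by omega]
  exact (card_le_card h).trans ((card_union_le _ _).trans (Nat.add_le_add_right card_image_le _))

/-- A pair `e ∈ E`, `n ∉ E` is an overflow for the shift `k = n - e`; `e < u` and `2 * u ≤ n` force
`k ≥ u`, so only long shifts occur. -/
lemma card_mul_card_le_sum_overflow (E : Finset ℕ) (N u : ℕ) :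
    #{e ∈ range u | e ∈ E} * #{n ∈ range N | 2 * u ≤ n ∧ n ∉ E} ≤
      ∑ k ∈ Ico u N, overflow E N k := by
  rw [← card_product, card_eq_sum_card_fiberwise (f := fun x : ℕ × ℕ => x.2 - x.1) (t := Ico u N)]
  · apply sum_le_sum
    intro k _
    apply card_le_card_of_injOn Prod.snd
    · rintro ⟨e, n⟩ hx
      simp only [mem_coe, mem_filter, mem_product, mem_range] at hx ⊢
      obtain ⟨⟨⟨h1, h2⟩, h3, h4, h5⟩, rfl⟩ := hx
      exact ⟨h3, by omega, by rwa [show n - (n - e) = e by omega], h5⟩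
    · rintro ⟨e, n⟩ hx ⟨e', n'⟩ hx' h
      simp only [mem_coe, mem_filter, mem_product, mem_range] at hx hx' h
      subst h
      have : e = e' := by omega
      rw [this]
  · rintro ⟨e, n⟩ hx
    simp only [mem_coe, mem_filter, mem_product, mem_range, mem_Ico] at hx ⊢
    omega

/-- A set `E` that is sparse up to `N` but has a positive proportion of every not too short
initial segment cannot be almost closed under translation by `1` and by its own elements, provided
that the total deficiency is less than one. -/
lemma one_le_of_overflow_le {N : ℕ} {E : Finset ℕ} {ε δ : ℝ} (hN : 0 < N)
    (hε : 0 < ε) (hε2 : ε ≤ 1 / 2) (hδ : 0 < δ) (hδ' : δ ≤ ε ^ 4 / 20000)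
    (hlow : ∀ l ≤ N, 8 * N * δ / ε ≤ l → l * ε / 2 ≤ #{n ∈ range l | n ∈ E})
    (hup : N * ε / 2 ≤ #{n ∈ range N | n ∉ E})
    (hφ1 : overflow E N 1 ≤ 4 * N * δ) : 1 ≤ 4 * N * δ := by
  by_contra! hD
  have hN' : (0 : ℝ) < N := by exact_mod_cast hN
  have hφ : overflow E N 1 = 0 := by
    have : (overflow E N 1 : ℝ) < 1 := by linarith
    exact_mod_cast Nat.lt_one_iff.1 (by exact_mod_cast this)
  have hstep : ∀ j, j + 1 < N → j ∈ E → j + 1 ∈ E := by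
    intro j hj hjE
    by_contra hnot
    have := filter_eq_empty_iff.1 (card_eq_zero.1 hφ) (mem_range.2 hj)
    exact this ⟨by omega, by simpa using hjE, hnot⟩
  set c := #{n ∈ range N | n ∉ E} with hc
  obtain ⟨n, hnN, hnE, hcn⟩ : ∃ n < N, n ∉ E ∧ c ≤ n + 1 := by
    by_contra! hno
    have hsub : {n ∈ range N | n ∉ E} ⊆ range (c - 1) := by
      intro n hn
      simp only [mem_filter, mem_range] at hn ⊢
      have := hno n hn.1 hn.2
      omega
    have h1 := card_le_card hsub
    rw [card_range, ← hc] at h1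
    have : (0 : ℝ) < c := by
      have : (0 : ℝ) < N * ε / 2 := by positivity
      linarith
    have : 0 < c := by exact_mod_cast this
    omega
  have hnone : ∀ j ≤ n, j ∉ E := by
    intro j hj hjE
    apply hnE
    have : ∀ i, j + i ≤ n → j + i ∈ E := by
      intro i
      induction i with
      | zero => intro _; exact hjE
      | succ i ih =>
        intro h
        rw [← add_assoc] at h ⊢
        exact hstep (j + i) (by omega) (ih (by omega))
    have := this (n - j) (by omega)
    rwa [show j + (n - j) = n by omega] at this
  have hcn' : (c : ℝ) ≤ ((n + 1 : ℕ) : ℝ) := by exact_mod_cast hcn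
  -- This places `n + 1 ≥ c ≥ N ε / 2` in the range of `hlow`, while `E` misses all of `[0, n]`.
  have hδε : δ ≤ ε ^ 2 / 16 := by
    have : ε ^ 4 ≤ ε ^ 2 := pow_le_pow_of_le_one hε.le (by linarith) (by norm_num)
    have := sq_nonneg ε
    linarith
  have h8 : 8 * N * δ / ε ≤ N * ε / 2 := by
    rw [div_le_iff₀ hε]
    nlinarith
  have hlow' := hlow (n + 1) (by omega) (by linarith)
  have hz : #{i ∈ range (n + 1) | i ∈ E} = 0 := by
    rw [card_eq_zero, filter_eq_empty_iff]
    intro i hi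
    exact hnone i (by simpa [Nat.lt_succ_iff] using hi)
  rw [hz] at hlow'
  have : (0 : ℝ) < ((n + 1 : ℕ) : ℝ) * ε / 2 := by positivity
  push_cast at *
  linarith

/-- There is a point near the origin from which on `E` has positive lower density. -/
lemma exists_good_start {N : ℕ} {E : Finset ℕ} {ε B : ℝ} (hε : 0 < ε) (hB : 0 < B)
    (hlow : ∀ l ≤ N, B ≤ l → l * ε / 2 ≤ #{n ∈ range l | n ∈ E}) :
    ∃ y ≤ N, (y : ℝ) < B ∧ ∀ l, y + l ≤ N →
      l * (ε / 4) ≤ #{n ∈ range l | y + n ∈ E} := by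
  -- At a minimum of the excess over density `ε / 4`, every later window has nonnegative excess. The
  -- excess vanishes at `0` and is positive from `B` on, so `y < B`.
  obtain ⟨y, hy, hmin⟩ := exists_min_image (range (N + 1))
    (fun y : ℕ => (#{n ∈ range y | n ∈ E} : ℝ) - y * (ε / 4)) ⟨0, by simp⟩
  have hyN : y ≤ N := by simpa [Nat.lt_succ_iff] using hy
  refine ⟨y, hyN, ?_, ?_⟩
  · by_contra! hBy
    have h1 := hlow y hyN hBy
    have h2 := hmin 0 (by simp)
    simp only [range_zero, filter_empty, card_empty, Nat.cast_zero, zero_mul, sub_zero] at h2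
    have : 0 < (y : ℝ) * ε := mul_pos (by linarith) hε
    linarith
  · intro l hl
    have h1 := hmin (y + l) (by simp; omega)
    have h2 : #{n ∈ range (y + l) | n ∈ E} =
        #{n ∈ range y | n ∈ E} + #{n ∈ range l | y + n ∈ E} := by
      simp only [card_filter]
      exact sum_range_add (fun n => if n ∈ E then 1 else 0) y l
    rw [h2] at h1
    push_cast at h1
    linarith

/-- Shifts with small overflow add up, at the cost of adding the overflows. Those of the form `y +
j` already include `j = 0`, `j = 1` and all of `E - y`, a set of Schnirelmann density at least `ε /
8`, so boundedly many of them reach every long shift. -/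
lemma overflow_le_of_schnirelmann {N : ℕ} {E : Finset ℕ} {ε D B : ℝ} (hε : 0 < ε)
    (hε2 : ε ≤ 1 / 2) (hB : 0 < B) (hBN : B < N) (hD : 0 ≤ D)
    (hlow : ∀ l ≤ N, B ≤ l → l * ε / 2 ≤ #{n ∈ range l | n ∈ E})
    (hφ : ∀ k ∈ E, overflow E N k ≤ D) (hφ1 : overflow E N 1 ≤ D) :
    ∀ k < N, 17 / ε * B ≤ k → overflow E N k ≤ 34 / ε * D := by
  obtain ⟨y, hyN, hyB, hy⟩ := exists_good_start hε hB hlow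
  have hyN' : y < N := by
    have : (y : ℝ) < N := by linarith
    exact_mod_cast this
  have hyE : y ∈ E := by
    have h1 := hy 1 (by omega)
    have h2 : 0 < #{n ∈ range 1 | y + n ∈ E} := by
      have : (0 : ℝ) < #{n ∈ range 1 | y + n ∈ E} := by
        refine lt_of_lt_of_le ?_ h1
        simp only [Nat.cast_one, one_mul]
        linarith
      exact_mod_cast this
    obtain ⟨n, hn⟩ := card_pos.1 h2
    simp only [range_one, mem_filter, mem_singleton] at hn
    obtain ⟨rfl, hn⟩ := hn
    simpa using hn
  -- The grading by `h` records both the accumulated offset `h * y` and the overflow budget; `2 * D`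
  -- per summand allows for the shift `1 + y`.
  let T : ℕ → Set ℕ := fun h => {j | (overflow E N (j + h * y) : ℝ) ≤ h * (2 * D)}
  have hTadd : ∀ a b, ∀ s ∈ T a, ∀ t ∈ T b, s + t ∈ T (a + b) := by
    intro a b s hs t ht
    simp only [T, Set.mem_ofPred_eq] at hs ht ⊢
    have : overflow E N (s + t + (a + b) * y) ≤
        overflow E N (s + a * y) + overflow E N (t + b * y) := by
      rw [show s + t + (a + b) * y = (s + a * y) + (t + b * y) by ring]
      exact overflow_add_le _ _ _ _
    have : (overflow E N (s + t + (a + b) * y) : ℝ) ≤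
        overflow E N (s + a * y) + overflow E N (t + b * y) := by exact_mod_cast this
    push_cast
    linarith
  have hT_mem : ∀ j, y + j ∈ E → j ∈ T 1 := by
    intro j hj
    simp only [T, Set.mem_ofPred_eq, one_mul, Nat.cast_one]
    have := hφ _ hj
    rw [add_comm] at this
    linarith
  have hT0 : 0 ∈ T 1 := hT_mem 0 (by simpa using hyE)
  have hT1 : 1 ∈ T 1 := by
    simp only [T, Set.mem_ofPred_eq, one_mul, Nat.cast_one]
    have h1 : (overflow E N (1 + y) : ℝ) ≤ overflow E N 1 + overflow E N y := by
      exact_mod_cast overflow_add_le E N 1 y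
    have := hφ y hyE
    linarith
  have hdens : ∀ n ≤ N - y - 1, ε / 8 * n ≤ posCount (T 1) n := by
    classical
    intro n hn
    rcases Nat.eq_zero_or_pos n with rfl | hpos
    · simp
    by_cases hsmall : (n : ℝ) * (ε / 8) ≤ 1
    -- The density of `E - y` counts `0`, which `posCount` ignores. For small `n` the element `1`
    -- makes up for this; for large `n` half of the density `ε / 4` does.
    · have h1 : 1 ≤ posCount (T 1) n := by
        apply Nat.succ_le_of_lt
        apply card_pos.2
        exact ⟨1, by simp only [mem_filter, mem_Ioc]; exact ⟨⟨by omega, by omega⟩, hT1⟩⟩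
      have : (1 : ℝ) ≤ posCount (T 1) n := by exact_mod_cast h1
      linarith
    · push Not at hsmall
      have h1 := hy (n + 1) (by omega)
      have h2 : #{j ∈ range (n + 1) | y + j ∈ E} ≤ posCount (T 1) n + 1 := by
        have hsub : {j ∈ range (n + 1) | y + j ∈ E} ⊆ insert 0 {j ∈ Ioc 0 n | j ∈ T 1} := by
          intro j hj
          simp only [mem_filter, mem_range, mem_insert, mem_Ioc] at hj ⊢
          rcases Nat.eq_zero_or_pos j with h | h
          · exact Or.inl h
          · exact Or.inr ⟨⟨h, by omega⟩, hT_mem j hj.2⟩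
        exact (card_le_card hsub).trans (card_insert_le _ _)
      have h3 : (#{j ∈ range (n + 1) | y + j ∈ E} : ℝ) ≤ posCount (T 1) n + 1 := by
        exact_mod_cast h2
      push_cast at h1
      linarith
  have hall := mem_of_schnirelmann (M := N - y - 1) (T := T) (σ := ε / 8) (by linarith)
    (by linarith) hT0 hTadd hdens
  set h := 2 * ⌈1 / (ε / 8)⌉₊ with hh
  have hhpos : 1 ≤ h := by
    have : 0 < ⌈1 / (ε / 8)⌉₊ := Nat.ceil_pos.2 (by positivity)
    omega
  have hhle : (h : ℝ) ≤ 17 / ε := by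
    have h1 := Nat.ceil_lt_add_one (a := 1 / (ε / 8)) (by positivity)
    have h2 : 1 / (ε / 8) = 8 / ε := by field_simp
    have h3 : 2 ≤ 1 / ε := by rw [le_div_iff₀ hε]; linarith
    have h4 : 17 / ε = 2 * (8 / ε) + 1 / ε := by ring
    have h5 : (h : ℝ) = 2 * (⌈1 / (ε / 8)⌉₊ : ℝ) := by rw [hh]; push_cast; ring
    rw [h5, h4]
    have h6 : (⌈1 / (ε / 8)⌉₊ : ℝ) ≤ 8 / ε + 1 := by rw [h2] at h1 ⊢; exact h1.le
    by_cases h7 : 1 / ε = 2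
    · have : ε = 1 / 2 := by field_simp at h7; linarith
      subst this
      norm_num
    · linarith
  intro k hk hBk
  have hhy : h * y ≤ k := by
    have : (h : ℝ) * y ≤ k := by
      refine le_trans ?_ hBk
      exact mul_le_mul hhle hyB.le (Nat.cast_nonneg _) (by positivity)
    exact_mod_cast this
  have hmem := hall (k - h * y) (by
    have : y ≤ h * y := Nat.le_mul_of_pos_left _ hhpos
    omega)
  simp only [T, Set.mem_ofPred_eq] at hmem
  rw [show k - h * y + h * y = k by omega] at hmem
  refine hmem.trans ?_
  calc (h : ℝ) * (2 * D) ≤ 17 / ε * (2 * D) := by gcongr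
    _ = 34 / ε * D := by ring

/-- Long shifts have overflow `O(N δ / ε)`, so their total is `O(N ^ 2 * δ / ε)`, whereas double
counting gives a total of order `N ^ 2 * ε ^ 3`. This is the source of the fourth power in `δ ≤ c ε
^ 4`. -/
lemma false_of_overflow_le {N : ℕ} {E : Finset ℕ} {ε δ : ℝ} (hN : 0 < N)
    (hε : 0 < ε) (hε2 : ε ≤ 1 / 2) (hδ : 0 < δ) (hδ' : δ ≤ ε ^ 4 / 20000)
    (hlow : ∀ l ≤ N, 8 * N * δ / ε ≤ l → l * ε / 2 ≤ #{n ∈ range l | n ∈ E})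
    (hup : N * ε / 2 ≤ #{n ∈ range N | n ∉ E})
    (hφ : ∀ k ∈ E, overflow E N k ≤ 4 * N * δ) (hφ1 : overflow E N 1 ≤ 4 * N * δ) : False := by
  have hD := one_le_of_overflow_le hN hε hε2 hδ hδ' hlow hup hφ1
  have hN' : (0 : ℝ) < N := by exact_mod_cast hN
  have hε3 : 0 < ε ^ 3 := by positivity
  have hε2' : ε ^ 2 ≤ ε / 2 := by nlinarith
  have hε3' : ε ^ 3 ≤ ε / 4 := by nlinarith
  set B := 8 * N * δ / ε with hB
  have hBle : B ≤ 8 * N * ε ^ 3 / 20000 := by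
    rw [hB, div_le_iff₀ hε]
    have := mul_le_mul_of_nonneg_left hδ' hN'.le
    nlinarith
  have hB0 : 0 < B := by positivity
  have hNε : 2 ≤ N * ε / 8 := by
    have h1 : 4 * N * (ε ^ 4 / 20000) ≤ 4 * N * (ε / 20000) := by
      have : ε ^ 4 ≤ ε := by
        calc ε ^ 4 ≤ ε ^ 1 := pow_le_pow_of_le_one hε.le (by linarith) (by norm_num)
          _ = ε := pow_one ε
      gcongr
    have h2 : 4 * N * δ ≤ 4 * N * (ε ^ 4 / 20000) := by gcongr
    nlinarith
  have hNε3 : N * ε ^ 3 ≤ N * ε / 4 := by nlinarith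
  have hφk := overflow_le_of_schnirelmann hε hε2 hB0 (by nlinarith) (by linarith) hlow hφ hφ1
  -- Discarding `[0, 2u)` costs at most half of the guaranteed `N ε / 2` points outside `E`, and `u`
  -- still exceeds the threshold `17 / ε * B`.
  obtain ⟨u, hu⟩ : ∃ u, u = ⌊N * ε / 8⌋₊ := ⟨_, rfl⟩
  have hu1 : (u : ℝ) ≤ N * ε / 8 := by rw [hu]; exact Nat.floor_le (by positivity)
  have hu2 : N * ε / 16 ≤ u := by
    have := Nat.lt_floor_add_one (N * ε / 8)
    rw [← hu] at this
    linarith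
  have hBu : 17 / ε * B ≤ u := by
    have h1 : 17 / ε * B ≤ 17 / ε * (8 * N * ε ^ 3 / 20000) := by gcongr
    have h2 : 17 / ε * (8 * N * ε ^ 3 / 20000) = 136 / 20000 * (N * ε ^ 2) := by
      field_simp; ring
    have h3 : N * ε ^ 2 ≤ N * (ε / 2) := by gcongr
    linarith
  have huN : u ≤ N := by
    have : (u : ℝ) ≤ N := by nlinarith
    exact_mod_cast this
  have hcount1 : u * ε / 2 ≤ #{e ∈ range u | e ∈ E} := hlow u huN (by linarith)
  have hcount2 : N * ε / 4 ≤ #{n ∈ range N | 2 * u ≤ n ∧ n ∉ E} := by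
    have hsub : {n ∈ range N | n ∉ E} ⊆ range (2 * u) ∪ {n ∈ range N | 2 * u ≤ n ∧ n ∉ E} := by
      intro n hn
      simp only [mem_filter, mem_range, mem_union] at hn ⊢
      by_cases h : n < 2 * u
      · exact Or.inl h
      · exact Or.inr ⟨hn.1, by omega, hn.2⟩
    have h1 := (card_le_card hsub).trans (card_union_le _ _)
    rw [card_range] at h1
    have h2 : (#{n ∈ range N | n ∉ E} : ℝ) ≤ 2 * u + #{n ∈ range N | 2 * u ≤ n ∧ n ∉ E} := by
      exact_mod_cast h1
    linarith
  have hsum : ((#{e ∈ range u | e ∈ E} : ℝ) * #{n ∈ range N | 2 * u ≤ n ∧ n ∉ E}) ≤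
      ∑ k ∈ Ico u N, (overflow E N k : ℝ) := by
    exact_mod_cast card_mul_card_le_sum_overflow E N u
  have hsum2 : ∑ k ∈ Ico u N, (overflow E N k : ℝ) ≤ N * (34 / ε * (4 * N * δ)) := by
    refine (sum_le_card_nsmul _ _ (34 / ε * (4 * N * δ)) ?_).trans ?_
    · intro k hk
      rw [mem_Ico] at hk
      refine hφk k hk.2 (hBu.trans ?_)
      exact_mod_cast hk.1
    · rw [nsmul_eq_mul, Nat.card_Ico]
      gcongr
      omega
  have hupper : N * (34 / ε * (4 * N * δ)) ≤ 136 / 20000 * (N ^ 2 * ε ^ 3) := by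
    calc N * (34 / ε * (4 * N * δ)) ≤ N * (34 / ε * (4 * N * (ε ^ 4 / 20000))) := by gcongr
      _ = 136 / 20000 * (N ^ 2 * ε ^ 3) := by field_simp; ring
  -- The constant `1 / 20000` is small enough that `136 / 20000 < 1 / 128`.
  have hlower : N ^ 2 * ε ^ 3 / 128 ≤
      (#{e ∈ range u | e ∈ E} : ℝ) * #{n ∈ range N | 2 * u ≤ n ∧ n ∉ E} := by
    calc N ^ 2 * ε ^ 3 / 128 = (N * ε / 16 * ε / 2) * (N * ε / 4) := by ring
      _ ≤ _ := mul_le_mul ((by gcongr : N * ε / 16 * ε / 2 ≤ u * ε / 2).trans hcount1) hcount2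
          (by positivity) (by positivity)
  have : 0 < N ^ 2 * ε ^ 3 := by positivity
  linarith

/-! ### The gain in entropy -/

lemma exists_large_gain {N : ℕ} {ε δ η : ℝ} {α : ℕ → ℝ} (hN : 2 ≤ N) (hε : 0 < ε)
    (hε2 : ε ≤ 1 / 2) (hδ : 0 < δ) (hδ' : δ ≤ ε ^ 4 / 20000) (hη0 : 0 ≤ η) (hη : η ≤ ε / 8)
    (hα0 : ∀ n < N, 0 ≤ α n) (hα1 : ∀ n < N, α n ≤ 1)
    (h0 : 0 < α 0) (h1 : 0 < α 1)
    (hup : ∑ n ∈ range N, α n ≤ N * (1 - ε))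
    (hlow : ∀ l ≤ N, N * δ ≤ l → l * ε ≤ ∑ n ∈ range l, α n) :
    ∃ k < N, 0 < α k ∧
      N * δ ≤ ∑ n ∈ Ico k N, max 0 (min (α (n - k)) (1 - α n) - η) := by
  classical
  by_contra! hno
  have hN' : (0 : ℝ) < N := by exact_mod_cast (by omega : 0 < N)
  have hε4 : ε ^ 4 ≤ ε := by
    calc ε ^ 4 ≤ ε ^ 1 := pow_le_pow_of_le_one hε.le (by linarith) (by norm_num)
      _ = ε := pow_one ε
  set g : ℕ → ℝ := fun n => max 0 (min (α n) (1 - α n) - η) with hg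
  have hg0 : ∀ n, 0 ≤ g n := fun n => le_max_left _ _
  have hgsum : ∀ l ≤ N, ∑ n ∈ range l, g n ≤ N * δ := by
    intro l hl
    -- `m 0 > 1` makes the shift `k = 0` available, which bounds the mass of intermediate values of
    -- `α`; `m 1 > 1` later supplies the shift `1`.
    have h2 := hno 0 (by omega) h0
    simp only [tsub_zero] at h2
    rw [← range_eq_Ico] at h2
    exact (sum_le_sum_of_subset_of_nonneg (range_mono hl) fun n _ _ => hg0 n).trans h2.le
  set E : Finset ℕ := {n ∈ range N | 1 / 2 ≤ α n} with hE
  have hφ : ∀ k < N, 0 < α k → (overflow E N k : ℝ) ≤ 4 * N * δ := by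
    intro k hk hαk
    have h2 := hno k hk hαk
    have h3 : (overflow E N k : ℝ) * (1 / 4) ≤
        ∑ n ∈ Ico k N, max 0 (min (α (n - k)) (1 - α n) - η) := by
      unfold overflow
      rw [← nsmul_eq_mul]
      refine (card_nsmul_le_sum _ (fun n => max 0 (min (α (n - k)) (1 - α n) - η)) _ ?_).trans
        (sum_le_sum_of_subset_of_nonneg ?_ fun n _ _ => le_max_left _ _)
      · intro n hn
        simp only [mem_filter, mem_range, hE, not_and, not_le] at hn
        obtain ⟨h4, h5, h6, h7⟩ := hn
        refine le_max_of_le_right ?_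
        have := le_min h6.2 (by linarith [h7 h4] : 1 / 2 ≤ 1 - α n)
        linarith
      · intro n hn
        simp only [mem_filter, mem_range, mem_Ico] at hn ⊢
        exact ⟨hn.2.1, hn.1⟩
    linarith
  refine false_of_overflow_le (N := N) (E := E) (by omega) hε hε2 hδ hδ' ?_ ?_ ?_
    (hφ 1 (by omega) h1)
  · intro l hl hBl
    have h8 : 8 * N * δ ≤ l * ε := by rwa [div_le_iff₀ hε] at hBl
    have h9 : N * δ ≤ l := by
      have : (l : ℝ) * ε ≤ l * 1 := by gcongr; linarith
      have : 0 < N * δ := by positivity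
      linarith
    have hterm : ∀ n ∈ range l, α n ≤ (if n ∈ E then (1 : ℝ) else 0) + (η + g n) := by
      intro n hn
      have hnl : n < N := (mem_range.1 hn).trans_le hl
      split_ifs with h
      · linarith [hg0 n, hα1 n hnl]
      · have h' : α n < 1 / 2 := by
          by_contra! hh
          exact h (mem_filter.2 ⟨mem_range.2 hnl, hh⟩)
        have := le_max_right 0 (min (α n) (1 - α n) - η)
        rw [min_eq_left (by linarith)] at this
        simp only [hg]
        rw [min_eq_left (by linarith)]
        linarith
    have hs := sum_le_sum hterm
    rw [sum_add_distrib, sum_add_distrib, sum_boole, sum_const, card_range, nsmul_eq_mul] at hs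
    have h10 := hlow l hl h9
    have h11 := hgsum l hl
    have h12 : (l : ℝ) * η ≤ l * (ε / 8) := by gcongr
    linarith
  · have hterm : ∀ n ∈ range N, 1 - α n ≤ (if n ∉ E then (1 : ℝ) else 0) + (η + g n) := by
      intro n hn
      have hnl : n < N := mem_range.1 hn
      by_cases h : n ∈ E
      · rw [if_neg (not_not.2 h)]
        have h' : 1 / 2 ≤ α n := (mem_filter.1 h).2
        have := le_max_right 0 (min (α n) (1 - α n) - η)
        rw [min_eq_right (by linarith)] at this
        simp only [hg]
        rw [min_eq_right (by linarith)]
        linarith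
      · rw [if_pos h]
        linarith [hg0 n, hα0 n hnl]
    have hs := sum_le_sum hterm
    rw [sum_add_distrib, sum_add_distrib, sum_boole, sum_sub_distrib, sum_const, sum_const,
      card_range, nsmul_eq_mul, nsmul_eq_mul] at hs
    have h11 := hgsum N le_rfl
    have h12 : (N : ℝ) * η ≤ N * (ε / 8) := by gcongr
    have h13 : N * δ ≤ N * (ε / 8) := by gcongr; linarith
    have h14 : 0 < N * ε := by positivity
    linarith
  · intro k hk
    simp only [hE, mem_filter, mem_range] at hk
    exact hφ k hk.1 (by linarith [hk.2])
/-! ### Entropy of `x + ω a y` along the filtration by powers of an ideal -/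

section SumLabel

open Classical

lemma card_subtype_prod {X : Type*} (𝒜 : Finset X) (P : X × X → Prop) [DecidablePred P] :
    #{t : 𝒜 × 𝒜 | P (t.1, t.2)} = #{s ∈ 𝒜 ×ˢ 𝒜 | P s} := by
  refine card_bij (fun t _ => ((t.1 : X), (t.2 : X))) ?_ ?_ ?_
  · rintro ⟨⟨x, hx⟩, ⟨y, hy⟩⟩ h
    simpa [hx, hy] using h
  · rintro ⟨⟨x, hx⟩, ⟨y, hy⟩⟩ - ⟨⟨x', hx'⟩, ⟨y', hy'⟩⟩ - h
    simpa using h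
  · rintro ⟨x, y⟩ h
    simp only [mem_filter, mem_product] at h
    exact ⟨(⟨x, h.1.1⟩, ⟨y, h.1.2⟩), by simpa using h.2, rfl⟩

variable {R : Type*} [CommRing R] {I : Ideal R} {𝒜 : Finset R}

/-- The residue class of `x + ω a y` modulo `I ^ n`. -/
def sumLabel (I : Ideal R) (𝒜 : Finset R) (a ω : R) (n : ℕ) (t : 𝒜 × 𝒜) : R ⧸ I ^ n :=
  Ideal.Quotient.mk (I ^ n) (t.1 + ω * a * t.2)

/-- The residue classes of `x` modulo `I ^ n` and of `y` modulo `I ^ (n - k)`. -/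
def pairLabel (I : Ideal R) (𝒜 : Finset R) (n k : ℕ) (t : 𝒜 × 𝒜) :
    (R ⧸ I ^ n) × (R ⧸ I ^ (n - k)) :=
  (Ideal.Quotient.mk (I ^ n) t.1, Ideal.Quotient.mk (I ^ (n - k)) t.2)

variable {N k : ℕ} {c m : ℕ → ℕ}

lemma fiberCard_pairLabel (hc : ∀ n ≤ N, ∀ x ∈ 𝒜, #{t ∈ 𝒜 | t - x ∈ I ^ n} = c n) {n : ℕ}
    (hn : n ≤ N) (t : 𝒜 × 𝒜) : fiberCard (pairLabel I 𝒜 n k) t = c n * c (n - k) := by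
  rw [← hc n hn _ t.1.2, ← hc (n - k) (by omega) _ t.2.2, ← card_product, ← filter_product]
  refine Eq.trans ?_ (card_subtype_prod 𝒜 _)
  unfold fiberCard pairLabel
  congr 1
  ext s
  simp [Ideal.Quotient.eq]

/-- The pairs of `𝒜 × 𝒜` that have the same labels as `(x, y)`. -/
noncomputable def jointFiber (I : Ideal R) (𝒜 : Finset R) (a : R) (n k : ℕ) (x y ω : R) :
    Finset (R × R) :=
  {s ∈ 𝒜 ×ˢ 𝒜 | (s.1 - x ∈ I ^ n ∧ s.2 - y ∈ I ^ (n - k)) ∧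
    s.1 + ω * a * s.2 - (x + ω * a * y) ∈ I ^ (n + 1)}

lemma fiberCard_joint (a ω : R) (n : ℕ) (t : 𝒜 × 𝒜) :
    fiberCard (fun t => (pairLabel I 𝒜 n k t, sumLabel I 𝒜 a ω (n + 1) t)) t =
      #(jointFiber I 𝒜 a n k t.1 t.2 ω) := by
  unfold jointFiber
  refine Eq.trans ?_ (card_subtype_prod 𝒜 _)
  unfold fiberCard pairLabel sumLabel
  congr 1
  ext s
  simp only [mem_filter, mem_univ, true_and, Prod.mk.injEq, Ideal.Quotient.eq]

lemma card_jointFiber_le (hc : ∀ n ≤ N, ∀ x ∈ 𝒜, #{t ∈ 𝒜 | t - x ∈ I ^ n} = c n) {n : ℕ}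
    (hn : n < N) (a ω x : R) {y : R} (hy : y ∈ 𝒜) :
    #(jointFiber I 𝒜 a n k x y ω) ≤ c (n + 1) * c (n - k) := by
  rw [← hc (n - k) (by omega) y hy]
  refine card_le_mul_card_image_of_maps_to (f := Prod.snd) ?_ _ ?_
  · intro s hs
    simp only [jointFiber, mem_filter, mem_product] at hs ⊢
    exact ⟨hs.1.2, hs.2.1.2⟩
  · intro b _
    rcases (filter (fun s : R × R => s.2 = b) (jointFiber I 𝒜 a n k x y ω)).eq_empty_or_nonempty
      with h | ⟨⟨x₀, b₀⟩, h₀⟩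
    · simp [h]
    · simp only [jointFiber, mem_filter, mem_product] at h₀
      obtain ⟨⟨⟨h1, -⟩, -, h2⟩, rfl⟩ := h₀
      rw [← hc (n + 1) (by omega) x₀ h1]
      apply card_le_card_of_injOn Prod.fst
      · rintro ⟨x', b'⟩ hs
        simp only [jointFiber, mem_coe, mem_filter, mem_product] at hs ⊢
        obtain ⟨⟨⟨h3, -⟩, -, h4⟩, rfl⟩ := hs
        refine ⟨h3, ?_⟩
        have := sub_mem h4 h2
        ring_nf at this ⊢
        exact this
      · rintro ⟨x', b'⟩ hs ⟨x'', b''⟩ hs' h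
        simp only [mem_coe, mem_filter] at hs hs' h
        rw [h, hs.2, hs'.2]

/-- If the second coordinate agrees with `y` to one more level, then so does the first with `x`, for
every `ω`. Otherwise two admissible `ω, ω'` give `(ω - ω') a (s₂ - y) ∈ I ^ (n + 1)`, and cancelling
the exact valuations leaves `ω - ω' ∈ I`, so `ω = ω'`. -/
lemma sum_card_jointFiber_le (hc : ∀ n ≤ N, ∀ x ∈ 𝒜, #{t ∈ 𝒜 | t - x ∈ I ^ n} = c n) {a : R}
    (ha : a ∈ I ^ k)
    (hcancel : ∀ (j : ℕ) (s v : R), v ∈ I ^ j → v ∉ I ^ (j + 1) →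
      s * (a * v) ∈ I ^ (k + j + 1) → s ∈ I)
    {Ω : Finset R} (hΩ : ∀ ω ∈ Ω, ∀ ω' ∈ Ω, ω - ω' ∈ I → ω = ω')
    {n : ℕ} (hn : n < N) (hk : k ≤ n) {x y : R} (hx : x ∈ 𝒜) (hy : y ∈ 𝒜) :
    ∑ ω ∈ Ω, #(jointFiber I 𝒜 a n k x y ω) ≤
      #Ω * (c (n + 1) * c (n - k + 1)) + c n * c (n - k) := by
  have hsplit : ∀ ω, #(jointFiber I 𝒜 a n k x y ω) ≤
      c (n + 1) * c (n - k + 1) + #{s ∈ ({t ∈ 𝒜 | t - x ∈ I ^ n} ×ˢ {t ∈ 𝒜 | t - y ∈ I ^ (n - k)}) |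
        s.2 - y ∉ I ^ (n - k + 1) ∧ s.1 + ω * a * s.2 - (x + ω * a * y) ∈ I ^ (n + 1)} := by
    intro ω
    rw [← hc (n + 1) (by omega) x hx, ← hc (n - k + 1) (by omega) y hy, ← card_product]
    refine (card_le_card ?_).trans (card_union_le _ _)
    rintro ⟨s₁, s₂⟩ hs
    simp only [jointFiber, mem_filter, mem_product, mem_union] at hs ⊢
    obtain ⟨⟨h1, h2⟩, ⟨h3, h4⟩, h5⟩ := hs
    by_cases h6 : s₂ - y ∈ I ^ (n - k + 1)
    · refine Or.inl ⟨⟨h1, ?_⟩, h2, h6⟩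
      have h7 : a * (s₂ - y) ∈ I ^ (n + 1) := by
        have := Ideal.mul_mem_mul ha h6
        rw [← pow_add] at this
        rwa [show k + (n - k + 1) = n + 1 by omega] at this
      have := sub_mem h5 (Ideal.mul_mem_left _ ω h7)
      ring_nf at this ⊢
      exact this
    · exact Or.inr ⟨⟨⟨h1, h3⟩, h2, h4⟩, h6, h5⟩
  refine (sum_le_sum fun ω _ => hsplit ω).trans ?_
  rw [sum_add_distrib, sum_const, smul_eq_mul]
  refine Nat.add_le_add_left ?_ _
  rw [← hc n hn.le x hx, ← hc (n - k) (by omega) y hy, ← card_product]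
  simp only [card_filter _ (_ ×ˢ _)]
  rw [sum_comm, card_eq_sum_ones]
  apply sum_le_sum
  rintro ⟨s₁, s₂⟩ hs
  simp only [mem_filter, mem_product] at hs
  rw [← card_filter, card_le_one]
  intro ω hω ω' hω'
  simp only [mem_filter] at hω hω'
  apply hΩ ω hω.1 ω' hω'.1
  refine hcancel (n - k) _ (s₂ - y) hs.2.2 hω.2.1 ?_
  rw [show k + (n - k) + 1 = n + 1 by omega]
  have := sub_mem hω.2.2 hω'.2.2
  ring_nf at this ⊢
  exact this

/-- The first alternative for `ρ` uses the bound valid for each `ω` separately, the second the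
collision bound on average over `ω` together with concavity of the logarithm. -/
lemma sum_log_fiberCard_joint_le
    (hc : ∀ n ≤ N, ∀ x ∈ 𝒜, #{t ∈ 𝒜 | t - x ∈ I ^ n} = c n)
    (hm : ∀ n < N, c n = m n * c (n + 1)) {a : R} (ha : a ∈ I ^ k)
    (hcancel : ∀ (j : ℕ) (s v : R), v ∈ I ^ j → v ∉ I ^ (j + 1) →
      s * (a * v) ∈ I ^ (k + j + 1) → s ∈ I)
    {Ω : Finset R} (hΩ0 : Ω.Nonempty) (hΩ : ∀ ω ∈ Ω, ∀ ω' ∈ Ω, ω - ω' ∈ I → ω = ω')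
    {n : ℕ} (hn : n < N) {ρ : ℝ}
    (hρ : ρ ≤ Real.log (m n) ∨
      k ≤ n ∧ ρ ≤ -Real.log (1 / (m n * m (n - k)) + 1 / #Ω)) (t : 𝒜 × 𝒜) :
    ∑ ω ∈ Ω, Real.log
      (fiberCard (fun t => (pairLabel I 𝒜 n k t, sumLabel I 𝒜 a ω (n + 1) t)) t) ≤
      #Ω * (Real.log (fiberCard (pairLabel I 𝒜 n k) t) - ρ) := by
  have hcpos : ∀ i ≤ N, 0 < c i := by
    intro i hi
    rw [← hc i hi _ t.1.2]
    exact card_pos.2 ⟨t.1, by simp⟩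
  have hmpos : ∀ i < N, 0 < m i := by
    intro i hi
    have := hcpos i hi.le
    rw [hm i hi] at this
    exact Nat.pos_of_mul_pos_right this
  have hΩpos : (0 : ℝ) < #Ω := by exact_mod_cast card_pos.2 hΩ0
  have c1 : (0 : ℝ) < c n := by exact_mod_cast hcpos n hn.le
  have c2 : (0 : ℝ) < c (n + 1) := by exact_mod_cast hcpos (n + 1) hn
  have c3 : (0 : ℝ) < c (n - k) := by exact_mod_cast hcpos (n - k) (by omega)
  have m1 : (0 : ℝ) < m n := by exact_mod_cast hmpos n hn
  have e1 : (c n : ℝ) = m n * c (n + 1) := by exact_mod_cast hm n hn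
  have hpos : ∀ ω ∈ Ω, (0 : ℝ) < fiberCard
      (fun t => (pairLabel I 𝒜 n k t, sumLabel I 𝒜 a ω (n + 1) t)) t :=
    fun ω _ => by exact_mod_cast fiberCard_pos _ t
  rw [fiberCard_pairLabel hc hn.le]
  push_cast
  rcases hρ with h | ⟨hk, h⟩
  · have h1 : Real.log (c (n + 1) * c (n - k)) ≤ Real.log (c n * c (n - k)) - ρ := by
      rw [e1, mul_assoc, Real.log_mul m1.ne' (by positivity)]
      linarith
    refine le_trans ?_ (mul_le_mul_of_nonneg_left h1 hΩpos.le)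
    rw [← nsmul_eq_mul]
    apply sum_le_card_nsmul
    intro ω hω
    apply Real.log_le_log (hpos ω hω)
    rw [fiberCard_joint]
    exact_mod_cast card_jointFiber_le hc hn a ω _ t.2.2
  · have m2 : (0 : ℝ) < m (n - k) := by exact_mod_cast hmpos (n - k) (by omega)
    have e2 : (c (n - k) : ℝ) = m (n - k) * c (n - k + 1) := by
      exact_mod_cast hm (n - k) (by omega)
    have hV : (0 : ℝ) < 1 / (m n * m (n - k)) + 1 / #Ω := by positivity
    have h1 : Real.log (c n * c (n - k) * (1 / (m n * m (n - k)) + 1 / #Ω)) ≤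
        Real.log (c n * c (n - k)) - ρ := by
      rw [Real.log_mul (by positivity) hV.ne']
      linarith
    refine le_trans ?_ (mul_le_mul_of_nonneg_left h1 hΩpos.le)
    refine sum_log_le Ω _ hpos (by positivity) ?_
    simp only [fiberCard_joint]
    have h2 := sum_card_jointFiber_le hc ha hcancel hΩ hn hk t.1.2 t.2.2
    have h3 : (∑ ω ∈ Ω, (#(jointFiber I 𝒜 a n k t.1 t.2 ω) : ℝ)) ≤
        #Ω * (c (n + 1) * c (n - k + 1)) + c n * c (n - k) := by exact_mod_cast h2
    refine h3.trans (le_of_eq ?_)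
    rw [e1, e2]
    field_simp

lemma sum_coEntropy_sumLabel_le
    (hc : ∀ n ≤ N, ∀ x ∈ 𝒜, #{t ∈ 𝒜 | t - x ∈ I ^ n} = c n)
    (hm : ∀ n < N, c n = m n * c (n + 1)) {a : R} (ha : a ∈ I ^ k)
    (hcancel : ∀ (j : ℕ) (s v : R), v ∈ I ^ j → v ∉ I ^ (j + 1) →
      s * (a * v) ∈ I ^ (k + j + 1) → s ∈ I)
    {Ω : Finset R} (hΩ0 : Ω.Nonempty) (hΩ : ∀ ω ∈ Ω, ∀ ω' ∈ Ω, ω - ω' ∈ I → ω = ω')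
    {ρ : ℕ → ℝ} (hρ : ∀ n < N, ρ n ≤ Real.log (m n) ∨
      k ≤ n ∧ ρ n ≤ -Real.log (1 / (m n * m (n - k)) + 1 / #Ω)) :
    ∀ n ≤ N, ∑ ω ∈ Ω, coEntropy (sumLabel I 𝒜 a ω n) ≤
      #Ω * (Fintype.card (𝒜 × 𝒜) *
        (Real.log (Fintype.card (𝒜 × 𝒜)) - ∑ i ∈ range n, ρ i)) := by
  intro n
  induction n with
  | zero =>
    intro _
    rw [range_zero, sum_empty, sub_zero, ← nsmul_eq_mul]
    apply sum_le_card_nsmul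
    intro ω _
    unfold coEntropy
    rw [← nsmul_eq_mul, ← card_univ]
    apply sum_le_card_nsmul
    intro t _
    apply Real.log_le_log (by exact_mod_cast fiberCard_pos _ t)
    exact_mod_cast card_le_card (subset_univ _)
  | succ n ih =>
    intro hn
    have h1 : ∀ ω ∈ Ω, coEntropy (sumLabel I 𝒜 a ω (n + 1)) ≤ coEntropy (sumLabel I 𝒜 a ω n) +
        coEntropy (fun t => (pairLabel I 𝒜 n k t, sumLabel I 𝒜 a ω (n + 1) t)) -
        coEntropy (pairLabel I 𝒜 n k) := by
      intro ω _
      have := coEntropy_add_le (sumLabel I 𝒜 a ω n) (sumLabel I 𝒜 a ω (n + 1))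
        (pairLabel I 𝒜 n k) ?_ ?_
      · linarith
      · intro s t h
        simp only [sumLabel, Ideal.Quotient.eq] at h ⊢
        exact Ideal.pow_le_pow_right (Nat.le_succ n) h
      · intro s t h
        simp only [sumLabel, pairLabel, Prod.mk.injEq, Ideal.Quotient.eq] at h ⊢
        -- Truncated subtraction is harmless: for `n < k` nothing is known about `y`, but `a ∈ I ^
        -- k` alone suffices.
        have h2 : a * ((s.2 : R) - t.2) ∈ I ^ n := by
          have := Ideal.mul_mem_mul ha h.2
          rw [← pow_add] at this
          exact Ideal.pow_le_pow_right (by omega) this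
        have := add_mem h.1 (Ideal.mul_mem_left _ ω h2)
        ring_nf at this ⊢
        exact this
    have h2 : ∑ ω ∈ Ω, coEntropy (fun t => (pairLabel I 𝒜 n k t, sumLabel I 𝒜 a ω (n + 1) t)) ≤
        #Ω * (coEntropy (pairLabel I 𝒜 n k) - Fintype.card (𝒜 × 𝒜) * ρ n) := by
      unfold coEntropy
      rw [sum_comm]
      refine (sum_le_sum fun t _ =>
        sum_log_fiberCard_joint_le hc hm ha hcancel hΩ0 hΩ (by omega) (hρ n (by omega)) t).trans ?_
      rw [← mul_sum, sum_sub_distrib, sum_const, card_univ, nsmul_eq_mul]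
    have h3 := sum_le_sum h1
    rw [sum_sub_distrib, sum_add_distrib, sum_const, nsmul_eq_mul] at h3
    have h4 := ih (by omega)
    rw [sum_range_succ]
    linarith

/-- For some `ω ∈ Ω` the number of residue classes of `x + ω a y` modulo `I ^ N` is bounded below
by the product of the average growth rates at the successive levels. -/
lemma exists_sum_le_log_card_image_sumLabel (h𝒜 : 𝒜.Nonempty)
    (hc : ∀ n ≤ N, ∀ x ∈ 𝒜, #{t ∈ 𝒜 | t - x ∈ I ^ n} = c n)
    (hm : ∀ n < N, c n = m n * c (n + 1)) {a : R} (ha : a ∈ I ^ k)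
    (hcancel : ∀ (j : ℕ) (s v : R), v ∈ I ^ j → v ∉ I ^ (j + 1) →
      s * (a * v) ∈ I ^ (k + j + 1) → s ∈ I)
    {Ω : Finset R} (hΩ0 : Ω.Nonempty) (hΩ : ∀ ω ∈ Ω, ∀ ω' ∈ Ω, ω - ω' ∈ I → ω = ω')
    {ρ : ℕ → ℝ} (hρ : ∀ n < N, ρ n ≤ Real.log (m n) ∨
      k ≤ n ∧ ρ n ≤ -Real.log (1 / (m n * m (n - k)) + 1 / #Ω)) :
    ∃ ω ∈ Ω, ∑ n ∈ range N, ρ n ≤ Real.log #(univ.image (sumLabel I 𝒜 a ω N)) := by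
  by_contra! hno
  have : Nonempty 𝒜 := h𝒜.to_subtype
  have hT : (0 : ℝ) < Fintype.card (𝒜 × 𝒜) := by exact_mod_cast Fintype.card_pos
  have h1 := sum_coEntropy_sumLabel_le hc hm ha hcancel hΩ0 hΩ hρ N le_rfl
  have h2 : ∑ _ω ∈ Ω, (Fintype.card (𝒜 × 𝒜) : ℝ) *
      (Real.log (Fintype.card (𝒜 × 𝒜)) - ∑ i ∈ range N, ρ i) <
      ∑ ω ∈ Ω, coEntropy (sumLabel I 𝒜 a ω N) := by
    apply sum_lt_sum_of_nonempty hΩ0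
    intro ω hω
    have h3 := card_mul_log_card_sub_coEntropy_le (sumLabel I 𝒜 a ω N)
    have h4 := mul_lt_mul_of_pos_left (hno ω hω) hT
    linarith
  rw [sum_const, nsmul_eq_mul] at h2
  linarith

end SumLabel
/-! ### Regular subsets -/

section Regular

variable {R : Type*} [CommRing R]

lemma mem_of_mul_mem_pow [IsDomain R] {ϖ : R} (hϖ : Prime ϖ) {j k : ℕ} {s a v : R}
    (ha : a ∈ Ideal.span {ϖ} ^ k) (ha' : a ∉ Ideal.span {ϖ} ^ (k + 1))
    (hv : v ∈ Ideal.span {ϖ} ^ j) (hv' : v ∉ Ideal.span {ϖ} ^ (j + 1))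
    (h : s * (a * v) ∈ Ideal.span {ϖ} ^ (k + j + 1)) : s ∈ Ideal.span {ϖ} := by
  simp only [Ideal.span_singleton_pow, Ideal.mem_span_singleton] at *
  obtain ⟨a, rfl⟩ := ha
  obtain ⟨v, rfl⟩ := hv
  rw [pow_succ, mul_dvd_mul_iff_left (pow_ne_zero _ hϖ.ne_zero)] at ha' hv'
  rw [show s * (ϖ ^ k * a * (ϖ ^ j * v)) = ϖ ^ (k + j) * (s * (a * v)) by ring, pow_succ,
    mul_dvd_mul_iff_left (pow_ne_zero _ hϖ.ne_zero)] at h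
  rcases hϖ.dvd_or_dvd h with h | h
  · exact h
  · rcases hϖ.dvd_or_dvd h with h | h
    · exact absurd h ha'
    · exact absurd h hv'

lemma exists_finset_bijOn_mk {J : Ideal R} [Finite (R ⧸ J)] (A : Set (R ⧸ J)) :
    ∃ 𝒜 : Finset R, Set.BijOn (Ideal.Quotient.mk J) 𝒜 A := by
  obtain ⟨s, -, hs⟩ := Set.SurjOn.exists_bijOn_subset
    (f := Ideal.Quotient.mk J) (s := Set.univ) (t := A) (fun x _ => by
      obtain ⟨y, rfl⟩ := Ideal.Quotient.mk_surjective x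
      exact ⟨y, trivial, rfl⟩)
  have hfin : s.Finite := (hs.finite_iff_finite).2 A.toFinite
  exact ⟨hfin.toFinset, by simpa using hs⟩

open Classical

variable {I : Ideal R} {𝒜 : Finset R} {N : ℕ} {A : Set (R ⧸ I ^ N)} {m : ℕ → ℕ}

lemma levelImage_eq_image (h𝒜 : Set.BijOn (Ideal.Quotient.mk (I ^ N)) 𝒜 A) {l : ℕ} (hl : l ≤ N) :
    levelImage I A l hl = (𝒜.image (Ideal.Quotient.mk (I ^ l)) : Finset (R ⧸ I ^ l)) := by
  unfold levelImage
  rw [← h𝒜.image_eq, Set.image_image, coe_image]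
  rfl

lemma card_image_of_isRegularSubset {m : Fin N → ℕ} (hA : IsRegularSubset I m A)
    (h𝒜 : Set.BijOn (Ideal.Quotient.mk (I ^ N)) 𝒜 A) (n : Fin N) {x : R} (hx : x ∈ 𝒜) :
    #({t ∈ 𝒜 | t - x ∈ I ^ (n : ℕ)}.image (Ideal.Quotient.mk (I ^ ((n : ℕ) + 1)))) = m n := by
  have hreg := hA n x (by
    rw [levelImage_eq_image h𝒜]
    exact mem_coe.2 (mem_image_of_mem _ hx))
  rw [← hreg, ← Set.ncard_coe_finset, levelImage_eq_image h𝒜]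
  congr 1
  ext z
  simp only [coe_image, coe_filter, Set.mem_image, Set.mem_inter_iff, Set.mem_ofPred_eq, mem_coe]
  constructor
  · rintro ⟨t, ⟨h1, h2⟩, rfl⟩
    exact ⟨⟨t, h1, rfl⟩, t, h2, rfl⟩
  · rintro ⟨⟨t, h1, rfl⟩, y, h2, h3⟩
    refine ⟨t, ⟨h1, ?_⟩, rfl⟩
    have := Ideal.pow_le_pow_right (Nat.le_succ n) (Ideal.Quotient.eq.1 h3)
    have := sub_mem h2 this
    ring_nf at this ⊢
    exact this

lemma card_eq_card_image_mul {𝒮 : Finset R} {l d : ℕ} (hsub : 𝒮 ⊆ 𝒜)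
    (hsat : ∀ t ∈ 𝒮, ∀ t' ∈ 𝒜, t' - t ∈ I ^ l → t' ∈ 𝒮)
    (hcard : ∀ x ∈ 𝒜, #{t ∈ 𝒜 | t - x ∈ I ^ l} = d) :
    #𝒮 = #(𝒮.image (Ideal.Quotient.mk (I ^ l))) * d := by
  rw [card_eq_sum_card_image (Ideal.Quotient.mk (I ^ l)) 𝒮, ← smul_eq_mul]
  apply sum_const_nat
  intro b hb
  obtain ⟨t, ht, rfl⟩ := mem_image.1 hb
  rw [← hcard t (hsub ht)]
  congr 1
  ext t'
  simp only [mem_filter, Ideal.Quotient.eq]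
  exact ⟨fun h => ⟨hsub h.1, h.2⟩, fun h => ⟨hsat t ht t' h.1 h.2, h.2⟩⟩

/-- Descending from level `N`, where classes are singletons, a class at level `n` splits into `m n`
classes of level `n + 1`, all of equal size. -/
lemma card_filter_sub_mem (hinj : ∀ x ∈ 𝒜, ∀ y ∈ 𝒜, x - y ∈ I ^ N → x = y)
    (hm : ∀ n < N, ∀ x ∈ 𝒜,
      #({t ∈ 𝒜 | t - x ∈ I ^ n}.image (Ideal.Quotient.mk (I ^ (n + 1)))) = m n) :
    ∀ n ≤ N, ∀ x ∈ 𝒜, #{t ∈ 𝒜 | t - x ∈ I ^ n} = ∏ i ∈ Ico n N, m i := by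
  intro n hn
  induction hn using Nat.decreasingInduction with
  | self =>
    intro x hx
    rw [Ico_self, prod_empty, card_eq_one]
    refine ⟨x, ?_⟩
    ext t
    simp only [mem_filter, mem_singleton]
    constructor
    · exact fun h => hinj t h.1 x hx h.2
    · rintro rfl
      exact ⟨hx, by simp⟩
  | of_succ n hn ih =>
    intro x hx
    rw [card_eq_card_image_mul (𝒜 := 𝒜) (filter_subset _ _) ?_ ih, hm n hn x hx,
      prod_eq_prod_Ico_succ_bot hn]
    intro t ht t' ht' htt'
    simp only [mem_filter] at ht ⊢
    refine ⟨ht', ?_⟩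
    have := add_mem (Ideal.pow_le_pow_right (Nat.le_succ n) htt') ht.2
    ring_nf at this ⊢
    exact this

lemma card_image_mul_prod (hinj : ∀ x ∈ 𝒜, ∀ y ∈ 𝒜, x - y ∈ I ^ N → x = y)
    (hm : ∀ n < N, ∀ x ∈ 𝒜,
      #({t ∈ 𝒜 | t - x ∈ I ^ n}.image (Ideal.Quotient.mk (I ^ (n + 1)))) = m n)
    (h𝒜 : 𝒜.Nonempty) {l : ℕ} (hl : l ≤ N) :
    #(𝒜.image (Ideal.Quotient.mk (I ^ l))) = ∏ i ∈ range l, m i := by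
  have hcard := card_filter_sub_mem hinj hm
  have h1 := card_eq_card_image_mul (𝒜 := 𝒜) (l := l) subset_rfl (fun _ _ t' h _ => h)
    (hcard l hl)
  obtain ⟨x, hx⟩ := h𝒜
  have h2 := hcard 0 (Nat.zero_le N) x hx
  simp only [pow_zero, Ideal.one_eq_top, Submodule.mem_top, filter_true] at h2
  rw [h2, ← prod_Ico_consecutive m (Nat.zero_le l) hl, ← range_eq_Ico] at h1
  have hpos : 0 < ∏ i ∈ Ico l N, m i := by
    rw [← hcard l hl x hx]
    exact card_pos.2 ⟨x, by simp [hx]⟩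
  exact (Nat.eq_of_mul_eq_mul_right hpos h1).symm

lemma card_image_le_card_quotient {ϖ : R} (hI : I = Ideal.span {ϖ}) [Finite (R ⧸ I)] (n : ℕ)
    (x : R) :
    #({t ∈ 𝒜 | t - x ∈ I ^ n}.image (Ideal.Quotient.mk (I ^ (n + 1)))) ≤ Nat.card (R ⧸ I) := by
  have := Fintype.ofFinite (R ⧸ I)
  rw [Nat.card_eq_fintype_card, ← card_univ]
  refine (card_le_card ?_).trans (card_image_le (s := (univ : Finset (R ⧸ I)))
    (f := fun r => Ideal.Quotient.mk (I ^ (n + 1)) (x + ϖ ^ n * r.out)))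
  intro z hz
  simp only [mem_image, mem_filter, mem_univ, true_and] at hz ⊢
  obtain ⟨t, ⟨-, ht⟩, rfl⟩ := hz
  have ht' := ht
  rw [hI, Ideal.span_singleton_pow, Ideal.mem_span_singleton] at ht'
  obtain ⟨s, hs⟩ := ht'
  refine ⟨Ideal.Quotient.mk I s, ?_⟩
  rw [Ideal.Quotient.eq]
  have h1 : (Ideal.Quotient.mk I s).out - s ∈ I := by
    rw [← Ideal.Quotient.eq]
    exact Ideal.Quotient.mk_out _
  have h2 : ϖ ^ n ∈ I ^ n := Ideal.pow_mem_pow (by rw [hI]; exact Ideal.mem_span_singleton_self ϖ) n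
  have h3 := Ideal.mul_mem_mul h2 h1
  rw [← pow_succ] at h3
  rw [show t = x + ϖ ^ n * s by rw [← hs]; ring]
  ring_nf at h3 ⊢
  exact h3

end Regular

/-! ### Choice of the level `k` and conclusion -/

/-- As `1 / (q - 1) ≤ 2 / q`, the sum is at most three times the larger of `1 / (a * b)` and `1 /
q`. This is the loss `log 3` that forces `q` to be large in terms of `ε`. -/
lemma log_inv_add_inv_le {a b q : ℝ} (ha : 0 < a) (hb : 0 < b) (hq : 2 ≤ q) :
    Real.log (1 / (a * b) + 1 / (q - 1)) ≤
      Real.log 3 - Real.log a - min (Real.log b) (Real.log q - Real.log a) := by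
  have hq0 : 0 < q := by linarith
  have hq1 : 0 < q - 1 := by linarith
  have h1 : 1 / (q - 1) ≤ 2 / q := by
    rw [div_le_div_iff₀ hq1 hq0]
    linarith
  have hpos : 0 < 1 / (a * b) + 1 / (q - 1) := by positivity
  rcases le_total (a * b) q with h | h
  · have h2 : 1 / q ≤ 1 / (a * b) := one_div_le_one_div_of_le (by positivity) h
    have h3 : 1 / (a * b) + 1 / (q - 1) ≤ 3 / (a * b) := by
      have e1 : 2 / q = 2 * (1 / q) := by ring
      have e2 : 3 / (a * b) = 3 * (1 / (a * b)) := by ring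
      linarith
    have h4 := Real.log_le_log hpos h3
    rw [Real.log_div (by norm_num) (by positivity), Real.log_mul ha.ne' hb.ne'] at h4
    have := min_le_left (Real.log b) (Real.log q - Real.log a)
    linarith
  · have h2 : 1 / (a * b) ≤ 1 / q := one_div_le_one_div_of_le hq0 h
    have h3 : 1 / (a * b) + 1 / (q - 1) ≤ 3 / q := by
      have e1 : 2 / q = 2 * (1 / q) := by ring
      have e2 : 3 / q = 3 * (1 / q) := by ring
      linarith
    have h4 := Real.log_le_log hpos h3
    rw [Real.log_div (by norm_num) hq0.ne'] at h4
    have := min_le_right (Real.log b) (Real.log q - Real.log a)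
    linarith

/-- A regular set has a level `k` at which it branches and at which the average growth rates
of `A + ω a A`, for `a` of valuation `k`, are large. -/
lemma exists_growth_rates {N q : ℕ} {ε δ : ℝ} {m : ℕ → ℕ} (hN : 2 ≤ N) (hε : 0 < ε)
    (hδ : 0 < δ) (hδ' : δ ≤ 1 / 20000 * ε ^ 4) (hq : Real.exp (8 * Real.log 3 / ε) ≤ q)
    (hm1 : ∀ n < N, 1 ≤ m n) (hmq : ∀ n < N, m n ≤ q) (h0 : 1 < m 0) (h1 : 1 < m 1)
    (hup : ((∏ n ∈ range N, m n : ℕ) : ℝ) ≤ (q : ℝ) ^ ((N : ℝ) * (1 - ε)))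
    (hlow : ∀ l ≤ N, (N : ℝ) * δ ≤ l →
      (q : ℝ) ^ ((l : ℝ) * ε) ≤ ((∏ n ∈ range l, m n : ℕ) : ℝ)) :
    ∃ k < N, 1 < m k ∧ ∃ ρ : ℕ → ℝ,
      (∀ n < N, ρ n ≤ Real.log (m n) ∨
        k ≤ n ∧ ρ n ≤ -Real.log (1 / (m n * m (n - k)) + 1 / ((q - 1 : ℕ) : ℝ))) ∧
      Real.log ((∏ n ∈ range N, m n : ℕ) : ℝ) + N * δ * Real.log q ≤ ∑ n ∈ range N, ρ n := by
  have hN' : (0 : ℝ) < N := by exact_mod_cast (by omega : 0 < N)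
  have hlog3 : 0 < Real.log 3 := Real.log_pos (by norm_num)
  have hq1 : (1 : ℝ) < q := lt_of_lt_of_le (Real.one_lt_exp_iff.2 (by positivity)) hq
  have hq2 : 2 ≤ q := by exact_mod_cast hq1
  have hq0 : (0 : ℝ) < q := by linarith
  have hL : 0 < Real.log q := Real.log_pos hq1
  have hmpos : ∀ n < N, (0 : ℝ) < m n := fun n hn => by exact_mod_cast hm1 n hn
  have hlogprod : ∀ l ≤ N, Real.log ((∏ n ∈ range l, m n : ℕ) : ℝ) =
      ∑ n ∈ range l, Real.log (m n) := by
    intro l hl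
    rw [Nat.cast_prod, Real.log_prod]
    intro n hn
    exact (hmpos n ((mem_range.1 hn).trans_le hl)).ne'
  have hprodpos : ∀ l ≤ N, (0 : ℝ) < ((∏ n ∈ range l, m n : ℕ) : ℝ) := by
    intro l hl
    rw [Nat.cast_prod]
    exact prod_pos fun n hn => hmpos n ((mem_range.1 hn).trans_le hl)
  have hup' : ∑ n ∈ range N, Real.log (m n) ≤ N * (1 - ε) * Real.log q := by
    have := Real.log_le_log (hprodpos N le_rfl) hup
    rwa [hlogprod N le_rfl, Real.log_rpow hq0] at this
  have hlow' : ∀ l ≤ N, (N : ℝ) * δ ≤ l → l * ε * Real.log q ≤ ∑ n ∈ range l, Real.log (m n) := by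
    intro l hl hNl
    have := Real.log_le_log (by positivity) (hlow l hl hNl)
    rwa [hlogprod l hl, Real.log_rpow hq0] at this
  have hlog0 : ∀ n < N, 0 ≤ Real.log (m n) := fun n hn =>
    Real.log_nonneg (by exact_mod_cast hm1 n hn)
  have hε1 : ε ≤ 1 := by
    have h2 : 0 ≤ N * (1 - ε) * Real.log q :=
      (sum_nonneg fun n hn => hlog0 n (mem_range.1 hn)).trans hup'
    by_contra! hh
    have : N * (1 - ε) * Real.log q < 0 :=
      mul_neg_of_neg_of_pos (mul_neg_of_pos_of_neg hN' (by linarith)) hL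
    linarith
  have hδ1 : δ ≤ 1 := by
    have : ε ^ 4 ≤ 1 := pow_le_one₀ hε.le hε1
    linarith
  -- The two size hypotheses at `l = N` give `ε ≤ 1 - ε`.
  have hε2 : ε ≤ 1 / 2 := by
    have h2 := (hlow' N le_rfl (by nlinarith)).trans hup'
    have h3 := le_of_mul_le_mul_right h2 hL
    have h4 := le_of_mul_le_mul_left h3 hN'
    linarith
  have hη : Real.log 3 / Real.log q ≤ ε / 8 := by
    have h2 : 8 * Real.log 3 / ε ≤ Real.log q := (Real.le_log_iff_exp_le hq0).2 hq
    rw [div_le_iff₀ hε] at h2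
    rw [div_le_iff₀ hL]
    linarith
  obtain ⟨k, hk, hαk, hgain⟩ := exists_large_gain (N := N) (ε := ε) (δ := δ)
    (η := Real.log 3 / Real.log q) (α := fun n => Real.log (m n) / Real.log q) hN hε hε2 hδ
    (by linarith) (by positivity) hη (fun n hn => div_nonneg (hlog0 n hn) hL.le)
    (fun n hn => by
      rw [div_le_one hL]
      exact Real.log_le_log (hmpos n hn) (by exact_mod_cast hmq n hn))
    (div_pos (Real.log_pos (by exact_mod_cast h0)) hL)
    (div_pos (Real.log_pos (by exact_mod_cast h1)) hL)
    (by rw [← sum_div, div_le_iff₀ hL]; exact hup')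
    (fun l hl hNl => by rw [← sum_div, le_div_iff₀ hL]; exact hlow' l hl hNl)
  have hlogk : 0 < Real.log (m k) := by
    by_contra! hh
    exact absurd (div_nonpos_of_nonpos_of_nonneg hh hL.le) (not_le.2 hαk)
  set g : ℕ → ℝ := fun n => max 0 (min (Real.log (m (n - k)) / Real.log q)
    (1 - Real.log (m n) / Real.log q) - Real.log 3 / Real.log q) with hg
  refine ⟨k, hk, ?_, fun n => Real.log (m n) + (if k ≤ n then g n * Real.log q else 0), ?_, ?_⟩
  · have := (Real.log_pos_iff (by positivity)).1 hlogk
    exact_mod_cast this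
  · intro n hn
    by_cases hkn : k ≤ n
    · simp only [if_pos hkn]
      rcases max_choice 0 (min (Real.log (m (n - k)) / Real.log q)
        (1 - Real.log (m n) / Real.log q) - Real.log 3 / Real.log q) with h | h
      · left
        simp only [hg, h]
        simp
      · right
        refine ⟨hkn, ?_⟩
        simp only [hg, h]
        have h2 := log_inv_add_inv_le (hmpos n hn) (hmpos (n - k) (by omega))
          (by exact_mod_cast hq2 : (2 : ℝ) ≤ q)
        have h3 : (min (Real.log (m (n - k)) / Real.log q) (1 - Real.log (m n) / Real.log q) -
            Real.log 3 / Real.log q) * Real.log q =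
            min (Real.log (m (n - k))) (Real.log q - Real.log (m n)) - Real.log 3 := by
          rw [sub_mul, min_mul_of_nonneg _ _ hL.le, sub_mul, div_mul_cancel₀ _ hL.ne',
            div_mul_cancel₀ _ hL.ne', div_mul_cancel₀ _ hL.ne', one_mul]
        rw [h3, Nat.cast_sub (by omega), Nat.cast_one]
        linarith
    · left
      simp [if_neg hkn]
  · rw [sum_add_distrib, hlogprod N le_rfl, ← sum_filter]
    have h2 : filter (fun n => k ≤ n) (range N) = Ico k N := by
      ext n
      simp only [mem_filter, mem_range, mem_Ico]
      exact and_comm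
    rw [h2, ← sum_mul]
    have := mul_le_mul_of_nonneg_right hgain hL.le
    linarith

lemma exists_expansion_of_isRegularSubset {R : Type*} [CommRing R] [IsDomain R] {ϖ : R}
    {I : Ideal R} {q : ℕ} {ε δ : ℝ} (hε : 0 < ε) (hδ : 0 < δ) (hδ' : δ ≤ 1 / 20000 * ε ^ 4)
    (hϖ : IsUniformizer ϖ) (hI : I = Ideal.span {ϖ}) (hqI : q = Nat.card (R ⧸ I))
    (hq : Real.exp (8 * Real.log 3 / ε) ≤ q) {Ω : Set R}
    (hΩ : Set.BijOn (Ideal.Quotient.mk I) Ω {x | IsUnit x}) {N : ℕ} (hN : 2 ≤ N) {m : Fin N → ℕ}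
    {A : Set (R ⧸ I ^ N)} (hA : A.Nonempty) (hreg : IsRegularSubset I m A)
    (h0 : 1 < m ⟨0, by omega⟩) (h1 : 1 < m ⟨1, by omega⟩)
    (hup : (A.ncard : ℝ) ≤ (q : ℝ) ^ ((N : ℝ) * (1 - ε)))
    (hlow : ∀ (l : ℕ) (hl : l ≤ N), (N : ℝ) * δ ≤ (l : ℝ) →
      (q : ℝ) ^ ((l : ℝ) * ε) ≤ ((levelImage I A l hl).ncard : ℝ)) :
    ∃ ω ∈ Ω, ∃ a ∈ A - A, (A.ncard : ℝ) * (q : ℝ) ^ ((N : ℝ) * δ) ≤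
      ((A + (Ideal.Quotient.mk (I ^ N) ω * a) • A).ncard : ℝ) := by
  classical
  have hq0 : (0 : ℝ) < q := (Real.exp_pos _).trans_le hq
  -- `Nat.card` is `0` on infinite types, so the lower bound on `q` already forces a finite residue
  -- ring.
  have hfinI : Finite (R ⧸ I) := Nat.finite_of_card_ne_zero (by
    rw [← hqI]
    exact_mod_cast hq0.ne')
  have hfin : ∀ n, Finite (R ⧸ I ^ n) := fun n =>
    Ideal.finite_quotient_pow ⟨{ϖ}, by simp [hI]⟩ n
  have hmax : I.IsMaximal := hI ▸ hϖ.2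
  have hprime : Prime ϖ := (Ideal.span_singleton_prime hϖ.1).1 hϖ.2.isPrime
  obtain ⟨𝒜, h𝒜⟩ := exists_finset_bijOn_mk A
  have h𝒜0 : 𝒜.Nonempty := by
    obtain ⟨x, hx⟩ := hA
    obtain ⟨t, ht, -⟩ := h𝒜.surjOn hx
    exact ⟨t, ht⟩
  have hinj : ∀ x ∈ 𝒜, ∀ y ∈ 𝒜, x - y ∈ I ^ N → x = y := fun x hx y hy h =>
    h𝒜.injOn hx hy (Ideal.Quotient.eq.2 h)
  -- The value `1` beyond `N` is a dummy; only indices below `N` enter.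
  obtain ⟨m', hm'⟩ : ∃ m' : ℕ → ℕ, ∀ n (h : n < N), m' n = m ⟨n, h⟩ :=
    ⟨fun n => if h : n < N then m ⟨n, h⟩ else 1, fun n h => dif_pos h⟩
  have hm : ∀ n < N, ∀ x ∈ 𝒜,
      #({t ∈ 𝒜 | t - x ∈ I ^ n}.image (Ideal.Quotient.mk (I ^ (n + 1)))) = m' n := by
    intro n hn x hx
    rw [hm' n hn]
    exact card_image_of_isRegularSubset hreg h𝒜 ⟨n, hn⟩ hx
  have hlevel : ∀ l (hl : l ≤ N), (levelImage I A l hl).ncard = ∏ n ∈ range l, m' n := by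
    intro l hl
    rw [levelImage_eq_image h𝒜, Set.ncard_coe_finset, card_image_mul_prod hinj hm h𝒜0 hl]
  have hcardA : A.ncard = ∏ n ∈ range N, m' n := by
    rw [← h𝒜.image_eq, ← coe_image, Set.ncard_coe_finset,
      card_image_mul_prod hinj hm h𝒜0 le_rfl]
  obtain ⟨x₀, hx₀⟩ := h𝒜0
  obtain ⟨k, hkN, hmk, ρ, hρ, hρsum⟩ := exists_growth_rates (m := m') hN hε hδ hδ' hq
    (fun n hn => by
      rw [← hm n hn x₀ hx₀]
      exact card_pos.2 (Nonempty.image ⟨x₀, by simp [hx₀]⟩ _))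
    (fun n hn => by
      rw [← hm n hn x₀ hx₀, hqI]
      exact card_image_le_card_quotient hI n x₀)
    (by rw [hm' 0 (by omega)]; exact h0) (by rw [hm' 1 (by omega)]; exact h1)
    (by rw [← hcardA]; exact hup)
    (fun l hl hNl => by rw [← hlevel l hl]; exact hlow l hl hNl)
  -- Branching at level `k` is exactly what provides a difference of valuation `k`.
  obtain ⟨t, ht, s, hs, hts, hts'⟩ : ∃ t ∈ 𝒜, ∃ s ∈ 𝒜, t - s ∈ I ^ k ∧ t - s ∉ I ^ (k + 1) := by
    rw [← hm k hkN x₀ hx₀, one_lt_card] at hmk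
    obtain ⟨u, hu, v, hv, huv⟩ := hmk
    simp only [mem_image, mem_filter] at hu hv
    obtain ⟨t, ⟨ht, htk⟩, rfl⟩ := hu
    obtain ⟨s, ⟨hs, hsk⟩, rfl⟩ := hv
    refine ⟨t, ht, s, hs, ?_, fun h => huv (Ideal.Quotient.eq.2 h)⟩
    have := sub_mem htk hsk
    ring_nf at this ⊢
    exact this
  have hΩfin : Ω.Finite := (hΩ.finite_iff_finite).2 (Set.toFinite _)
  have hΩcard : #hΩfin.toFinset = q - 1 := by
    let := Ideal.Quotient.field I
    have e1 : {x : R ⧸ I | IsUnit x} = {0}ᶜ := by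
      ext x
      simp [isUnit_iff_ne_zero]
    rw [← Set.ncard_eq_toFinset_card Ω hΩfin, Set.BijOn.ncard_eq hΩ, e1, Set.ncard_compl,
      Set.ncard_singleton, hqI]
  have hq1 : (1 : ℝ) < q := lt_of_lt_of_le (Real.one_lt_exp_iff.2 (by
    have : 0 < Real.log 3 := Real.log_pos (by norm_num)
    positivity)) hq
  have hΩ0 : hΩfin.toFinset.Nonempty := by
    rw [← card_pos, hΩcard]
    have : 1 < q := by exact_mod_cast hq1
    omega
  rw [← hΩcard] at hρ
  obtain ⟨ω, hω, hωρ⟩ := exists_sum_le_log_card_image_sumLabel (I := I) (𝒜 := 𝒜) (N := N) (k := k)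
    (c := fun n => ∏ i ∈ Ico n N, m' i) (m := m') ⟨x₀, hx₀⟩ (card_filter_sub_mem hinj hm)
    (fun n hn => prod_eq_prod_Ico_succ_bot hn m') hts
    (fun j s' v hv hv' h => by
      subst hI
      exact mem_of_mul_mem_pow hprime hts hts' hv hv' h)
    hΩ0 (fun ω hω ω' hω' h => hΩ.injOn (hΩfin.mem_toFinset.1 hω) (hΩfin.mem_toFinset.1 hω')
      (Ideal.Quotient.eq.2 h)) hρ
  refine ⟨ω, hΩfin.mem_toFinset.1 hω, Ideal.Quotient.mk (I ^ N) (t - s), ?_, ?_⟩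
  · rw [map_sub]
    exact Set.sub_mem_sub (h𝒜.mapsTo ht) (h𝒜.mapsTo hs)
  · set im := univ.image (sumLabel I 𝒜 (t - s) ω N) with him
    have hsub : (im : Set (R ⧸ I ^ N)) ⊆
        A + (Ideal.Quotient.mk (I ^ N) ω * Ideal.Quotient.mk (I ^ N) (t - s)) • A := by
      intro z hz
      rw [mem_coe, him, mem_image] at hz
      obtain ⟨⟨⟨x, hx⟩, ⟨y, hy⟩⟩, -, rfl⟩ := hz
      simp only [sumLabel, map_add, map_mul]
      exact Set.add_mem_add (h𝒜.mapsTo hx) (Set.smul_mem_smul_set (h𝒜.mapsTo hy))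
    have hle : (#im : ℝ) ≤
        ((A + (Ideal.Quotient.mk (I ^ N) ω * Ideal.Quotient.mk (I ^ N) (t - s)) • A).ncard : ℝ) := by
      rw [← Set.ncard_coe_finset im]
      exact_mod_cast Set.ncard_le_ncard hsub (Set.toFinite _)
    refine le_trans ?_ hle
    have hpos : (0 : ℝ) < A.ncard := by
      exact_mod_cast (Set.ncard_pos (Set.toFinite A)).2 hA
    have himpos : (0 : ℝ) < #im := by
      have : Nonempty 𝒜 := ⟨⟨x₀, hx₀⟩⟩
      exact_mod_cast card_pos.2 (univ_nonempty.image _)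
    rw [← Real.log_le_log_iff (by positivity) himpos, Real.log_mul hpos.ne' (by positivity),
      Real.log_rpow hq0, hcardA]
    exact hρsum.trans hωρ

end PadicSumProduct

theorem proposition2p9 :
    ∃ c : ℝ, 0 < c ∧ ∀ ε : ℝ, 0 < ε → ∃ Q : ℝ, ∀ δ : ℝ, 0 < δ → δ ≤ c * ε ^ 4 →
      ∀ (p : ℕ) [Fact p.Prime] (K : Type*) [Field K] [Algebra ℚ_[p] K] [FiniteDimensional ℚ_[p] K]
        (ϖ : PadicSumProduct.ringOfIntegers p K) (I : Ideal (PadicSumProduct.ringOfIntegers p K))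
        (q : ℕ),
        PadicSumProduct.IsUniformizer ϖ →
        I = Ideal.span {ϖ} →
        q = Nat.card (PadicSumProduct.ringOfIntegers p K ⧸ I) →
        Q ≤ (q : ℝ) →
      ∀ Ω : Set (PadicSumProduct.ringOfIntegers p K),
        Set.BijOn (Ideal.Quotient.mk I) Ω {x | IsUnit x} →
      ∀ (N : ℕ) (hN : 2 ≤ N) (m : Fin N → ℕ)
        (A : Set (PadicSumProduct.ringOfIntegers p K ⧸ I ^ N)),
        A.Nonempty →
        PadicSumProduct.IsRegularSubset I m A →
        1 < m ⟨0, by omega⟩ →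
        1 < m ⟨1, by omega⟩ →
        (A.ncard : ℝ) ≤ (q : ℝ) ^ ((N : ℝ) * (1 - ε)) →
        (∀ (l : ℕ) (hl : l ≤ N), (N : ℝ) * δ ≤ (l : ℝ) →
          (q : ℝ) ^ ((l : ℝ) * ε) ≤ ((PadicSumProduct.levelImage I A l hl).ncard : ℝ)) →
        ∃ ω ∈ Ω, ∃ a ∈ A - A,
          (A.ncard : ℝ) * (q : ℝ) ^ ((N : ℝ) * δ) ≤
            ((A + (Ideal.Quotient.mk (I ^ N) ω * a) • A).ncard : ℝ) := by
  refine ⟨1 / 20000, by norm_num, fun ε hε => ⟨Real.exp (8 * Real.log 3 / ε), ?_⟩⟩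
  intro δ hδ hδ' p _ K _ _ _ ϖ I q hϖ hI hqI hq Ω hΩ N hN m A hA hreg h0 h1 hup hlow
  exact PadicSumProduct.exists_expansion_of_isRegularSubset hε hδ hδ' hϖ hI hqI hq hΩ hN hA hreg
    h0 h1 hup hlow
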